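/- **Setting.** All matrices are real; $\langle A,B\rangle=\operatorname{tr}(A^{T}B)$ is the trace inner product, $\|\cdot\|_F$ the Frobenius norm, and $\|\cdot\|_*$ the nuclear norm (sum of the singular values). $\mathbf S_d$ is the space of symmetric $d\times d$ matrices, and $\mathbf S_d^+\subset\mathbf S_d$ the cone of positive semidefinite ones. Let $\phi$ be a real-valued convex, twice differentiable function on $\mathbf R^{d_1\times d_2}$ (asymmetric case) or on $\mathbf S_d^+$ (symmetric case; derivatives are taken within $\mathbf S_d^+$, so that $\nabla\phi(M)\in\mathbf S_d$ and $\nabla^2\phi(M)$ is a quadratic form on $\mathbf S_d$). For integers $k,\ell\ge 1$ and reals $L\ge\mu\ge 0$, say that $\phi$ has $(k,\ell,\mu,L)$-restricted strong convexity and smoothness if $$\mu\|E\|_F^2\le\nabla^2\phi(M)[E,E]\le L\|E\|_F^2$$ for all $M,E\in\mathbf R^{d_1\times d_2}$ (resp. $M\in\mathbf S_d^+$, $E\in\mathbf S_d$) with $\operatorname{rank}(M)\le\ell$ and $\operatorname{rank}(E)\le k$. Let $\mu_k^{(\ell)}(\phi)$ and $L_k^{(\ell)}(\phi)$ be the optimal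 (largest, resp. smallest) such constants $\mu$ and $L$. A second-order critical point of a twice differentiable function is a point at which the gradient is zero and the Hessian is positive semidefinite. **Theorem 3.5.** Let $r\ge r_*\ge 1$ be integers and $\lambda\ge 0$. Suppose that $\phi$ has $(r+r_*,r+r_*,\mu',L')$-restricted strong convexity and smoothness for some finite $\mu',L'$, put $$\mu=\mu_{r+r_*}^{(r+r_*)}(\phi),\qquad L=L_{r+r_*}^{(r+r_*)}(\phi),\qquad L_2=L_2^{(r+r_*)}(\phi),$$ and suppose $$\mu>\frac{L_2}{2\sqrt{r/r_*}+L_2/L}.$$ * *(Asymmetric case.)* Let $M_*\in\mathbf R^{d_1\times d_2}$ have rank at most $r_*$ and be a global optimum of $\min_{M}\phi(M)+\lambda\|M\|_*$ in the sense that $\nabla\phi(M_*)\in-\lambda\,\partial\|M_*\|_*$, where $\partial\|M_*\|_*$ is the set of $G$ with $\|N\|_*\ge\|M_*\|_*+\langle G,N-M_*\rangle$ for all $N\in\mathbf R^{d_1\times d_2}$. Then every second-order critical point $(U,V)\in\mathbf R^{d_1\times r}\times\mathbf R^{d_2\times r}$ of $$f_\lambda(U,V)=\phi(UV^{T})+\lambda\,\frac{\|U\|_F^2+\|V\|_F^2}{2}$$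 satisfies $UV^{T}=M_*$. * *(Symmetric case.)* Let $M_*\in\mathbf S_d^+$ have rank at most $r_*$ and be a global optimum of $\min_{M\succeq0}\phi(M)+\lambda\operatorname{tr}M$ in the sense that $(\nabla\phi(M_*)+\lambda I_d)M_*=0$ and $\nabla\phi(M_*)+\lambda I_d\succeq0$. Then every second-order critical point $U\in\mathbf R^{d\times r}$ of $$f_\lambda(U)=\phi(UU^{T})+\lambda\|U\|_F^2$$ satisfies $UU^{T}=M_*$. -/

import Mathlib

open Set Matrix

/- The norm on every matrix space is the Frobenius norm. -/
attribute [local instance] Matrix.frobeniusNormedAddCommGroup Matrix.frobeniusNormedSpace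

/-- The trace inner product `⟨A, B⟩ = tr(Aᵀ B)`; its norm is the Frobenius norm. -/
noncomputable instance matrixTraceInner (m n : ℕ) :
    InnerProductSpace ℝ (Matrix (Fin m) (Fin n) ℝ) where
  inner A B := (Aᵀ * B).trace
  norm_sq_eq_re_inner A := by
    rw [Matrix.frobenius_norm_def, ← Real.sqrt_eq_rpow, Real.sq_sqrt (by positivity)]
    simp only [Matrix.trace, Matrix.diag, Matrix.mul_apply, Matrix.transpose_apply,
      RCLike.re_to_real, Real.norm_eq_abs, Real.rpow_two, sq_abs]
    rw [Finset.sum_comm]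
    simp only [sq]
  conj_inner_symm A B := by
    simp only [conj_trivial]
    rw [← Matrix.trace_transpose, Matrix.transpose_mul, Matrix.transpose_transpose]
  add_left A B C := by
    rw [Matrix.transpose_add, Matrix.add_mul, Matrix.trace_add]
  smul_left A B c := by
    rw [Matrix.transpose_smul, Matrix.smul_mul, Matrix.trace_smul]
    simp

instance matrixFrobeniusComplete (m n : ℕ) :
    @CompleteSpace (Matrix (Fin m) (Fin n) ℝ) PseudoMetricSpace.toUniformSpace :=
  FiniteDimensional.complete ℝ _

/-- The space `𝐒_d` of real symmetric `d × d` matrices (with the trace inner product). -/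
def SymMat (d : ℕ) : Submodule ℝ (Matrix (Fin d) (Fin d) ℝ) where
  carrier := {A | A.IsSymm}
  add_mem' hA hB := Matrix.IsSymm.add hA hB
  zero_mem' := Matrix.isSymm_zero
  smul_mem' c _ hA := Matrix.IsSymm.smul hA c

instance symMatComplete (d : ℕ) :
    @CompleteSpace (SymMat d) PseudoMetricSpace.toUniformSpace :=
  FiniteDimensional.complete ℝ _

/-- The cone `𝐒_d⁺` of positive semidefinite matrices, as a subset of `𝐒_d`. -/
def psdCone (d : ℕ) : Set (SymMat d) := {M | (M : Matrix (Fin d) (Fin d) ℝ).PosSemidef}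

/-- `U Uᵀ` as an element of `𝐒_d`. -/
def symFactor {d r : ℕ} (U : Matrix (Fin d) (Fin r) ℝ) : SymMat d :=
  ⟨U * Uᵀ, show (U * Uᵀ)ᵀ = U * Uᵀ by rw [transpose_mul, transpose_transpose]⟩

/-- The nuclear norm: the sum of the singular values. (Mathlib's sequence of singular values of a
linear map vanishes from the dimension `n` of the domain on, and so lists all of them.) -/
noncomputable def nuclearNorm {m n : ℕ} (M : Matrix (Fin m) (Fin n) ℝ) : ℝ :=
  ∑ i ∈ Finset.range n, (Matrix.toEuclideanLin M).singularValues i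

/-- The subdifferential `∂‖M‖_*` of the nuclear norm at `M`. -/
def nuclearSubdifferential {m n : ℕ} (M : Matrix (Fin m) (Fin n) ℝ) :
    Set (Matrix (Fin m) (Fin n) ℝ) :=
  {G | ∀ N : Matrix (Fin m) (Fin n) ℝ,
    nuclearNorm M + inner ℝ G (N - M) ≤ nuclearNorm N}

section Calculus

variable {E : Type*} [NormedAddCommGroup E] [NormedSpace ℝ E]

/-- `φ` is twice differentiable on the set `s`. Derivatives are taken within `s`; they are unique
for the two sets used below, the whole matrix space and the cone `𝐒_d⁺` (a convex subset of `𝐒_d`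
with nonempty interior). Values of `φ` outside `s` play no role. -/
def TwiceDifferentiableOn (φ : E → ℝ) (s : Set E) : Prop :=
  DifferentiableOn ℝ φ s ∧ DifferentiableOn ℝ (fderivWithin ℝ φ s) s

/-- The Hessian quadratic form `∇²φ(M)[X, X]`, for `φ` on `s`. -/
noncomputable def hessForm (φ : E → ℝ) (s : Set E) (M X : E) : ℝ :=
  fderivWithin ℝ (fderivWithin ℝ φ s) s M X X

/-- `(k, ℓ, μ, L)`-restricted strong convexity and smoothness of `φ` on `s`, where `rk` is the rank
function of the matrix space `E`. -/
def IsRSCS (rk : E → ℕ) (s : Set E) (φ : E → ℝ) (k l : ℕ) (μ L : ℝ) : Prop :=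
  0 ≤ μ ∧ μ ≤ L ∧ TwiceDifferentiableOn φ s ∧
    ∀ M ∈ s, rk M ≤ l → ∀ X : E, rk X ≤ k →
      μ * ‖X‖ ^ 2 ≤ hessForm φ s M X ∧ hessForm φ s M X ≤ L * ‖X‖ ^ 2

/-- The optimal (largest) restricted strong convexity constant `μ_k^{(ℓ)}(φ)`. -/
noncomputable def optMu (rk : E → ℕ) (s : Set E) (φ : E → ℝ) (k l : ℕ) : ℝ :=
  sSup {μ | ∃ L, IsRSCS rk s φ k l μ L}

/-- The optimal (smallest) restricted smoothness constant `L_k^{(ℓ)}(φ)`. -/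
noncomputable def optL (rk : E → ℕ) (s : Set E) (φ : E → ℝ) (k l : ℕ) : ℝ :=
  sInf {L | ∃ μ, IsRSCS rk s φ k l μ L}

/-- The assumptions on `φ`, for search rank `r` and target rank bound `rs`: `φ` is convex on `s`,
it satisfies restricted strong convexity and smoothness at rank `r + rs` (so that the optimal
constants are defined), and with `μ = μ_{r+rs}(φ)`, `L = L_{r+rs}(φ)`, `L₂ = L_2^{(r+rs)}(φ)`,
one has `μ > L₂ / (2 √(r/rs) + L₂/L)`. -/
def LandscapeCondition (rk : E → ℕ) (s : Set E) (φ : E → ℝ) (r rs : ℕ) : Prop :=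
  ConvexOn ℝ s φ ∧
  (∃ μ L, IsRSCS rk s φ (r + rs) (r + rs) μ L) ∧
  optMu rk s φ (r + rs) (r + rs) >
    optL rk s φ 2 (r + rs) /
      (2 * √((r : ℝ) / rs) + optL rk s φ 2 (r + rs) / optL rk s φ (r + rs) (r + rs))

/-- `x` is a second-order critical point of the twice differentiable function `f`: the gradient
vanishes at `x` and the Hessian at `x` is positive semidefinite. -/
def IsSecondOrderCritical (f : E → ℝ) (x : E) : Prop :=
  fderiv ℝ f x = 0 ∧ ∀ v : E, 0 ≤ fderiv ℝ (fderiv ℝ f) x v v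

end Calculus

/-- The factored objective `f_λ(U, V) = φ(U Vᵀ) + λ (‖U‖_F² + ‖V‖_F²) / 2`. -/
noncomputable def asymObjective {d₁ d₂ : ℕ} (r : ℕ) (φ : Matrix (Fin d₁) (Fin d₂) ℝ → ℝ) (lam : ℝ) :
    Matrix (Fin d₁) (Fin r) ℝ × Matrix (Fin d₂) (Fin r) ℝ → ℝ :=
  fun p => φ (p.1 * p.2ᵀ) + lam * ((‖p.1‖ ^ 2 + ‖p.2‖ ^ 2) / 2)

/-- The factored objective `f_λ(U) = φ(U Uᵀ) + λ ‖U‖_F²`. -/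
noncomputable def symObjective {d : ℕ} (r : ℕ) (φ : SymMat d → ℝ) (lam : ℝ) :
    Matrix (Fin d) (Fin r) ℝ → ℝ :=
  fun U => φ (symFactor U) + lam * ‖U‖ ^ 2

/-- `M` is a global optimum of `φ + λ ‖·‖_*` in the sense that `∇φ(M) ∈ -λ ∂‖M‖_*`. -/
def IsAsymOptimum {d₁ d₂ : ℕ} (φ : Matrix (Fin d₁) (Fin d₂) ℝ → ℝ) (lam : ℝ)
    (M : Matrix (Fin d₁) (Fin d₂) ℝ) : Prop :=
  ∃ G ∈ nuclearSubdifferential M, gradient φ M = (-lam) • G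

/-- `M ⪰ 0` is a global optimum of `φ + λ tr` over the cone `𝐒_d⁺` in the sense of complementary
slackness, `(∇φ(M) + λ I) M = 0`, and dual feasibility, `∇φ(M) + λ I ⪰ 0`. The gradient is the one
in `𝐒_d` of `φ` on `𝐒_d⁺`. -/
def IsSymOptimum {d : ℕ} (φ : SymMat d → ℝ) (lam : ℝ) (M : SymMat d) : Prop :=
  M ∈ psdCone d ∧
  (((gradientWithin φ (psdCone d) M : SymMat d) : Matrix (Fin d) (Fin d) ℝ) + lam • 1) *
      (M : Matrix (Fin d) (Fin d) ℝ) = 0 ∧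
  (((gradientWithin φ (psdCone d) M : SymMat d) : Matrix (Fin d) (Fin d) ℝ) + lam • 1).PosSemidef

/-! Symmetric case. Put A = UUᵀ, S = ∇φ(A) + λI, T = ∇φ(M_*) + λI. First-order criticality says SU =
0. Testing the Hessian on x wᵀ, with w a unit vector minimizing |Uw|² = s, gives S ⪰ -L₂ s I, so S
can fail to be dual feasible only by as much as U is well conditioned. On the matrices supported on
the joint column space of U and M_*, all ranks are at most r + r_*, so φ has ordinary curvature
bounds there. The compression D of S - T to that space then satisfies ‖D‖² + μL‖A - M_*‖² ≤ (μ+L)⟨D,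
A - M_*⟩ (`restricted_cocoercivity`). Let N be the negative part of the compression of S: NU = 0 and
‖N‖_op ≤ L₂ s. Optimality of M_* allows N to replace D, giving ‖N‖² + μL‖A - M_*‖² ≤ (μ+L)⟨N, M_*⟩
(`eq_of_dual_matrices`).

This forces A = M_* (`eq_of_core_inequality`). Otherwise, let R project onto the column space of
M_*; completing the square in M_* leaves 4μ²L²‖A(1-R)‖² ≤ (L-μ)²‖NR‖². Let P project onto the range
of U and p = tr(PR). The left side is at least 4μ²L²s²(r-p), and the right side at most
(L-μ)²L₂²s²(r_*-p), because N vanishes on the range of U. The scale s cancels, and the hypothesis on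
μ, in the form (L₂(L-μ))² r_* < 4μ²L² r, yields (r-p) r_* < r (r_*-p), impossible when r_* ≤ r.

Asymmetric case. Stack U over V, and X over Y for a balanced factorization M_* = XYᵀ attaining the
nuclear norm; S and T become block matrices with λI on the diagonal and the gradient off it. If UᵀU
= VᵀV, the same argument applies with μ, L, L₂ halved (`asym_landscape_of_balanced`). For λ > 0 the
first-order equations force this balance. For λ = 0, either the gradient vanishes and cocoercivity
concludes, or U and V are injective and a change of basis balances them (`exists_balancing`). -/

/-! ### The trace inner product and elementary quadratic-form estimates. -/

section TraceForm

variable {m n p : Type*} [Fintype m] [Fintype n] [Fintype p]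

/-- The trace inner product, for matrices with arbitrary finite index types. -/
def trForm (A B : Matrix m n ℝ) : ℝ := (Aᵀ * B).trace

lemma trForm_eq_sum (A B : Matrix m n ℝ) : trForm A B = ∑ i, ∑ j, A i j * B i j := by
  simp only [trForm, Matrix.trace, Matrix.diag, Matrix.mul_apply, Matrix.transpose_apply]
  rw [Finset.sum_comm]

lemma trForm_comm (A B : Matrix m n ℝ) : trForm A B = trForm B A := by
  simp only [trForm_eq_sum, mul_comm]

lemma trForm_add_left (A B C : Matrix m n ℝ) : trForm (A + B) C = trForm A C + trForm B C := by
  simp [trForm, Matrix.add_mul]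

lemma trForm_add_right (A B C : Matrix m n ℝ) : trForm A (B + C) = trForm A B + trForm A C := by
  simp [trForm, Matrix.mul_add]

lemma trForm_sub_left (A B C : Matrix m n ℝ) : trForm (A - B) C = trForm A C - trForm B C := by
  simp [trForm, Matrix.sub_mul]

lemma trForm_sub_right (A B C : Matrix m n ℝ) : trForm A (B - C) = trForm A B - trForm A C := by
  simp [trForm, Matrix.mul_sub]

lemma trForm_smul_left (c : ℝ) (A B : Matrix m n ℝ) : trForm (c • A) B = c * trForm A B := by
  simp [trForm]

lemma trForm_smul_right (c : ℝ) (A B : Matrix m n ℝ) : trForm A (c • B) = c * trForm A B := by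
  simp [trForm]

@[simp] lemma trForm_zero_left (A : Matrix m n ℝ) : trForm 0 A = 0 := by simp [trForm]

@[simp] lemma trForm_zero_right (A : Matrix m n ℝ) : trForm A 0 = 0 := by simp [trForm]

lemma trForm_self_nonneg (A : Matrix m n ℝ) : 0 ≤ trForm A A := by
  rw [trForm_eq_sum]
  exact Finset.sum_nonneg fun i _ => Finset.sum_nonneg fun j _ => mul_self_nonneg _

lemma trForm_self_eq_zero {A : Matrix m n ℝ} : trForm A A = 0 ↔ A = 0 := by
  refine ⟨fun h => ?_, fun h => by simp [h]⟩
  rw [trForm_eq_sum] at h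
  ext i j
  have h1 := (Finset.sum_eq_zero_iff_of_nonneg
    (fun i _ => Finset.sum_nonneg fun j _ => mul_self_nonneg (A i j))).mp h i (Finset.mem_univ i)
  have h2 := (Finset.sum_eq_zero_iff_of_nonneg
    (fun j _ => mul_self_nonneg (A i j))).mp h1 j (Finset.mem_univ j)
  simpa using h2

lemma trForm_mul_left (A : Matrix m n ℝ) (B : Matrix n p ℝ) (C : Matrix m p ℝ) :
    trForm (A * B) C = trForm B (Aᵀ * C) := by
  simp [trForm, Matrix.mul_assoc]

lemma trForm_mul_right (A : Matrix m n ℝ) (B : Matrix n p ℝ) (C : Matrix m p ℝ) :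
    trForm (A * B) C = trForm A (C * Bᵀ) := by
  rw [trForm, trForm, transpose_mul, Matrix.mul_assoc, Matrix.trace_mul_comm, Matrix.mul_assoc]

lemma trForm_transpose (A B : Matrix m n ℝ) : trForm Aᵀ Bᵀ = trForm A B := by
  rw [trForm, trForm, ← Matrix.trace_transpose, Matrix.transpose_mul, Matrix.trace_mul_comm]
  simp

/-- `tr(Aᵀ A)` is the sum of the squared lengths of the columns. -/
lemma trForm_self_mul_eq_sum (A : Matrix m n ℝ) (Q : Matrix n p ℝ) :
    trForm (A * Q) (A * Q) = ∑ j, (A *ᵥ Q.col j) ⬝ᵥ (A *ᵥ Q.col j) := by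
  rw [trForm_eq_sum, Finset.sum_comm]
  rfl

lemma trForm_self_mul_le {q : Type*} [Fintype q] {A : Matrix m n ℝ} {B : Matrix q n ℝ} {c : ℝ}
    (h : ∀ x, (A *ᵥ x) ⬝ᵥ (A *ᵥ x) ≤ c * ((B *ᵥ x) ⬝ᵥ (B *ᵥ x))) (Q : Matrix n p ℝ) :
    trForm (A * Q) (A * Q) ≤ c * trForm (B * Q) (B * Q) := by
  rw [trForm_self_mul_eq_sum, trForm_self_mul_eq_sum, Finset.mul_sum]
  exact Finset.sum_le_sum fun j _ => h _

lemma mulVec_dotProduct_mulVec (A : Matrix m n ℝ) (B : Matrix m p ℝ) (x : n → ℝ) (y : p → ℝ) :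
    (A *ᵥ x) ⬝ᵥ (B *ᵥ y) = x ⬝ᵥ ((Aᵀ * B) *ᵥ y) := by
  rw [← Matrix.mulVec_mulVec, Matrix.dotProduct_mulVec x, Matrix.vecMul_transpose]

lemma dotProduct_self_nonneg' (x : n → ℝ) : 0 ≤ x ⬝ᵥ x :=
  Finset.sum_nonneg fun _ _ => mul_self_nonneg _

lemma dotProduct_sq_le (x y : n → ℝ) : (x ⬝ᵥ y) ^ 2 ≤ (x ⬝ᵥ x) * (y ⬝ᵥ y) := by
  simpa [dotProduct, sq] using Finset.sum_mul_sq_le_sq_mul_sq Finset.univ x y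

/-- Positive semidefinite matrices have nonnegative trace inner product. -/
lemma trForm_nonneg_of_psd {A B : Matrix n n ℝ} (hA : A.PosSemidef) (hB : B.PosSemidef) :
    0 ≤ trForm A B := by
  classical
  open scoped MatrixOrder in
  obtain ⟨X, rfl⟩ := CStarAlgebra.nonneg_iff_eq_star_mul_self.mp hA.nonneg
  have : trForm (star X * X) B = (X * B * Xᴴ).trace := by
    rw [Matrix.trace_mul_comm, trForm, Matrix.star_eq_conjTranspose]
    simp [Matrix.mul_assoc, conjTranspose_eq_transpose_of_trivial]
  rw [this]
  exact (hB.mul_mul_conjTranspose_same X).trace_nonneg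

lemma posSemidef_iff_dotProduct {A : Matrix n n ℝ} :
    A.PosSemidef ↔ Aᵀ = A ∧ ∀ x : n → ℝ, 0 ≤ x ⬝ᵥ (A *ᵥ x) := by
  rw [Matrix.posSemidef_iff_dotProduct_mulVec, Matrix.IsHermitian,
    conjTranspose_eq_transpose_of_trivial]
  simp

end TraceForm

/-! ### Diagonalization and the negative part of a symmetric matrix. -/

section Spectral

variable {n : Type*} [Fintype n] [DecidableEq n]

/-- A real symmetric matrix is orthogonally diagonalizable. -/
lemma exists_orthogonal_diagonal {S : Matrix n n ℝ} (hS : Sᵀ = S) :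
    ∃ (Q : Matrix n n ℝ) (e : n → ℝ), Qᵀ * Q = 1 ∧ Q * Qᵀ = 1 ∧ S = Q * diagonal e * Qᵀ := by
  have hH : S.IsHermitian := by rwa [Matrix.IsHermitian, conjTranspose_eq_transpose_of_trivial]
  refine ⟨hH.eigenvectorUnitary, hH.eigenvalues, ?_, ?_, ?_⟩
  · have := Unitary.coe_star_mul_self hH.eigenvectorUnitary
    rwa [Matrix.star_eq_conjTranspose, conjTranspose_eq_transpose_of_trivial] at this
  · have := Unitary.coe_mul_star_self hH.eigenvectorUnitary
    rwa [Unitary.coe_star, Matrix.star_eq_conjTranspose, conjTranspose_eq_transpose_of_trivial] at this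
  · have := hH.spectral_theorem
    rw [Unitary.conjStarAlgAut_apply, Matrix.star_eq_conjTranspose,
      conjTranspose_eq_transpose_of_trivial] at this
    exact this

lemma posSemidef_conj_diagonal (Q : Matrix n n ℝ) {f : n → ℝ} (hf : ∀ i, 0 ≤ f i) :
    (Q * diagonal f * Qᵀ).PosSemidef := by
  have := (PosSemidef.diagonal (d := f) (fun i => hf i)).mul_mul_conjTranspose_same Q
  rwa [conjTranspose_eq_transpose_of_trivial] at this

lemma dotProduct_mulVec_conj_diagonal (Q : Matrix n n ℝ) (f : n → ℝ) (x : n → ℝ) :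
    x ⬝ᵥ ((Q * diagonal f * Qᵀ) *ᵥ x) = ∑ i, f i * (Qᵀ *ᵥ x) i ^ 2 := by
  have : x ⬝ᵥ ((Q * diagonal f * Qᵀ) *ᵥ x) = (Qᵀ *ᵥ x) ⬝ᵥ (diagonal f *ᵥ (Qᵀ *ᵥ x)) := by
    rw [Matrix.mulVec_mulVec, mulVec_dotProduct_mulVec, transpose_transpose, Matrix.mul_assoc]
  rw [this, dotProduct]
  refine Finset.sum_congr rfl fun i _ => ?_
  rw [mulVec_diagonal]; ring

/-- The negative part `N` of a symmetric matrix `S`. -/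
lemma exists_neg_part {S : Matrix n n ℝ} (hS : Sᵀ = S) {τ : ℝ} (hτ : 0 ≤ τ)
    (hlow : ∀ x, -τ * (x ⬝ᵥ x) ≤ x ⬝ᵥ (S *ᵥ x)) :
    ∃ N : Matrix n n ℝ, N.PosSemidef ∧ (S + N).PosSemidef ∧ S * N = -(N * N) ∧
      ∀ x, (N *ᵥ x) ⬝ᵥ (N *ᵥ x) ≤ τ ^ 2 * (x ⬝ᵥ x) := by
  obtain ⟨Q, e, hQ1, hQ2, rfl⟩ := exists_orthogonal_diagonal hS
  have hmul : ∀ f g : n → ℝ, (Q * diagonal f * Qᵀ) * (Q * diagonal g * Qᵀ) =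
      Q * diagonal (fun i => f i * g i) * Qᵀ := by
    intro f g
    rw [← diagonal_mul_diagonal]
    calc _ = Q * diagonal f * (Qᵀ * Q) * diagonal g * Qᵀ := by simp only [Matrix.mul_assoc]
      _ = _ := by rw [hQ1]; simp only [Matrix.mul_assoc, Matrix.one_mul]
  -- The lower bound evaluated at the i-th eigenvector.
  have he : ∀ i, -τ ≤ e i := by
    intro i
    have := hlow (Q *ᵥ Pi.single i 1)
    rw [dotProduct_mulVec_conj_diagonal, mulVec_dotProduct_mulVec, Matrix.mulVec_mulVec, hQ1] at this
    simpa [Matrix.one_apply, Pi.single_apply, Finset.sum_ite_eq] using this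
  refine ⟨Q * diagonal (fun i => max (-e i) 0) * Qᵀ,
    posSemidef_conj_diagonal Q fun i => le_max_right _ _, ?_, ?_, fun x => ?_⟩
  · rw [← Matrix.add_mul, ← Matrix.mul_add, diagonal_add]
    refine posSemidef_conj_diagonal Q fun i => ?_
    have := le_max_left (-e i) 0
    linarith
  · rw [hmul, hmul, ← Matrix.neg_mul, ← Matrix.mul_neg, diagonal_neg]
    congr 3
    ext i
    rcases le_total (-e i) 0 with h | h
    · simp [max_eq_right h]
    · simp [max_eq_left h]
  · rw [mulVec_dotProduct_mulVec]
    have hT : (Q * diagonal (fun i => max (-e i) 0) * Qᵀ)ᵀ =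
        Q * diagonal (fun i => max (-e i) 0) * Qᵀ := by
      simp [Matrix.transpose_mul, Matrix.mul_assoc]
    rw [hT, hmul, dotProduct_mulVec_conj_diagonal]
    have hx : x ⬝ᵥ x = ∑ i, (Qᵀ *ᵥ x) i ^ 2 := by
      have : x ⬝ᵥ x = (Qᵀ *ᵥ x) ⬝ᵥ (Qᵀ *ᵥ x) := by
        rw [mulVec_dotProduct_mulVec, transpose_transpose, hQ2, one_mulVec]
      rw [this, dotProduct]
      exact Finset.sum_congr rfl fun i _ => (sq _).symm
    rw [hx, Finset.mul_sum]
    refine Finset.sum_le_sum fun i _ => mul_le_mul_of_nonneg_right ?_ (sq_nonneg _)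
    have h1 : max (-e i) 0 ≤ τ := max_le (by linarith [he i]) hτ
    have h2 : 0 ≤ max (-e i) 0 := le_max_right _ _
    nlinarith

end Spectral

/-! ### Orthogonal projections. -/

section Projection

variable {n : Type*} [Fintype n] [DecidableEq n]

/-- Orthogonal projection matrices. -/
def IsOrthProj (P : Matrix n n ℝ) : Prop := Pᵀ = P ∧ P * P = P

lemma IsOrthProj.one_sub {P : Matrix n n ℝ} (hP : IsOrthProj P) : IsOrthProj (1 - P) := by
  refine ⟨by simp [hP.1], ?_⟩
  simp [Matrix.sub_mul, Matrix.mul_sub, hP.2]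

lemma IsOrthProj.trForm_mul_self {n : Type*} [Fintype n] {P : Matrix n n ℝ} (hP : IsOrthProj P) {R : Matrix n n ℝ}
    (hR : IsOrthProj R) : trForm (P * R) (P * R) = trForm P R := by
  rw [trForm_mul_left, hP.1, ← Matrix.mul_assoc, hP.2, trForm_comm, trForm_mul_right, hR.1, hR.2]

lemma IsOrthProj.trForm_self_split {R : Matrix n n ℝ} (hR : IsOrthProj R) {m : Type*} [Fintype m]
    (A : Matrix m n ℝ) :
    trForm A A = trForm (A * R) (A * R) + trForm (A * (1 - R)) (A * (1 - R)) := by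
  rw [trForm_mul_right, trForm_mul_right, hR.1, hR.one_sub.1, Matrix.mul_assoc, Matrix.mul_assoc,
    hR.2, hR.one_sub.2, ← trForm_add_right, ← Matrix.mul_add]
  simp

lemma IsOrthProj.trForm_mul_left_le {R : Matrix n n ℝ} (hR : IsOrthProj R) {m : Type*} [Fintype m]
    (A : Matrix n m ℝ) : trForm (R * A) (R * A) ≤ trForm A A := by
  have := hR.trForm_self_split Aᵀ
  rw [← trForm_transpose A A, this, ← trForm_transpose (R * A), Matrix.transpose_mul, hR.1]
  linarith [trForm_self_nonneg (Aᵀ * (1 - R))]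

/-- The orthogonal projection onto the range of an injective matrix `U`. -/
lemma exists_range_projection {n : Type*} [Fintype n] {r : Type*} [Fintype r] [DecidableEq r] (U : Matrix n r ℝ) {s : ℝ}
    (hs : 0 < s) (hU : ∀ w, s * (w ⬝ᵥ w) ≤ (U *ᵥ w) ⬝ᵥ (U *ᵥ w)) :
    ∃ P : Matrix n n ℝ, IsOrthProj P ∧ P * U = U ∧ P.trace = Fintype.card r ∧
      (∀ N : Matrix n n ℝ, N * U = 0 → N * P = 0) ∧
      ∀ x, s ^ 2 * ((P *ᵥ x) ⬝ᵥ (P *ᵥ x)) ≤ ((U * Uᵀ) *ᵥ x) ⬝ᵥ ((U * Uᵀ) *ᵥ x) := by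
  have hdet : IsUnit (Uᵀ * U).det := by
    rw [← Matrix.isUnit_iff_isUnit_det, ← Matrix.mulVec_injective_iff_isUnit]
    rw [← Matrix.coe_mulVecLin, ← LinearMap.ker_eq_bot, LinearMap.ker_eq_bot']
    intro w hw
    have h1 : (U *ᵥ w) ⬝ᵥ (U *ᵥ w) = 0 := by
      rw [mulVec_dotProduct_mulVec]
      rw [Matrix.mulVecLin_apply] at hw
      rw [hw, dotProduct_zero]
    have h2 : w ⬝ᵥ w ≤ 0 := by
      have := hU w
      rw [h1] at this
      exact nonpos_of_mul_nonpos_right this hs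
    exact dotProduct_self_eq_zero.mp (le_antisymm h2 (dotProduct_self_nonneg' w))
  set G := Uᵀ * U with hG
  have hGt : Gᵀ = G := by simp [hG]
  have hGi : (G⁻¹)ᵀ = G⁻¹ := by rw [Matrix.transpose_nonsing_inv, hGt]
  refine ⟨U * G⁻¹ * Uᵀ, ⟨?_, ?_⟩, ?_, ?_, ?_, ?_⟩
  · simp [Matrix.transpose_mul, hGi, Matrix.mul_assoc]
  · calc U * G⁻¹ * Uᵀ * (U * G⁻¹ * Uᵀ) = U * (G⁻¹ * (Uᵀ * U)) * G⁻¹ * Uᵀ := by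
          simp only [Matrix.mul_assoc]
      _ = _ := by rw [← hG, Matrix.nonsing_inv_mul _ hdet, Matrix.mul_one]
  · rw [Matrix.mul_assoc, ← hG, Matrix.mul_assoc, Matrix.nonsing_inv_mul _ hdet, Matrix.mul_one]
  · rw [Matrix.trace_mul_comm, ← Matrix.mul_assoc, ← hG, Matrix.mul_nonsing_inv _ hdet,
      Matrix.trace_one]
  · intro N hN
    rw [← Matrix.mul_assoc, ← Matrix.mul_assoc, hN]
    simp
  · intro x
    set y := G⁻¹ *ᵥ (Uᵀ *ᵥ x) with hy
    set z := Uᵀ *ᵥ x with hz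
    have hzy : z = G *ᵥ y := by
      rw [hy, Matrix.mulVec_mulVec, Matrix.mul_nonsing_inv _ hdet, Matrix.one_mulVec]
    have hPx : (U * G⁻¹ * Uᵀ) *ᵥ x = U *ᵥ y := by
      rw [hy, hz]; simp only [Matrix.mulVec_mulVec, Matrix.mul_assoc]
    have hMx : (U * Uᵀ) *ᵥ x = U *ᵥ z := by rw [hz, Matrix.mulVec_mulVec]
    rw [hPx, hMx]
    have h1 : (U *ᵥ y) ⬝ᵥ (U *ᵥ y) = y ⬝ᵥ z := by rw [mulVec_dotProduct_mulVec, ← hG, hzy]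
    have h2 := hU y
    have h3 := hU z
    have h4 := dotProduct_sq_le y z
    rw [h1] at h2 ⊢
    have hyy := dotProduct_self_nonneg' y
    have hzz := dotProduct_self_nonneg' z
    -- Cauchy–Schwarz and s|y|² ≤ ⟨y, z⟩ give s⟨y, z⟩² ≤ ⟨y, z⟩|z|²; one factor cancels unless y =
    -- 0.
    have hyz : s * (y ⬝ᵥ z) ≤ z ⬝ᵥ z := by
      rcases hyy.eq_or_lt with h | h
      · rw [← h] at h2 h4
        have : y ⬝ᵥ z = 0 := by nlinarith
        rw [this]; simpa using hzz
      · have hpos : 0 < y ⬝ᵥ z := lt_of_lt_of_le (mul_pos hs h) h2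
        have h5 : s * (y ⬝ᵥ z) ^ 2 ≤ (y ⬝ᵥ z) * (z ⬝ᵥ z) := by nlinarith
        nlinarith
    nlinarith
end Projection

/-! ### The core inequality and its contradiction. -/

section Core

/-- Clearing L turns the hypothesis into L₂(L - μ) < 2μL√(r/rs), whose left side is nonnegative, so
it may be squared. -/
lemma scalar_gap {r rs : ℕ} (hrs : 1 ≤ rs) {μ L L₂ : ℝ} (hμ : 0 < μ) (hμL : μ ≤ L) (hL₂ : 0 ≤ L₂)
    (hgap : L₂ < μ * (2 * √((r : ℝ) / rs) + L₂ / L)) :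
    (L₂ * (L - μ)) ^ 2 * rs < 4 * μ ^ 2 * L ^ 2 * r := by
  have hL : 0 < L := hμ.trans_le hμL
  have hrs' : (0 : ℝ) < rs := by exact_mod_cast hrs
  have h1 : L₂ * (L - μ) < 2 * μ * L * √((r : ℝ) / rs) := by
    have : L₂ * L < L * (μ * (2 * √((r : ℝ) / rs) + L₂ / L)) := by nlinarith
    have e : L * (μ * (2 * √((r : ℝ) / rs) + L₂ / L)) = 2 * μ * L * √((r : ℝ) / rs) + μ * L₂ := by
      field_simp
    linarith
  have h0 : 0 ≤ L₂ * (L - μ) := mul_nonneg hL₂ (by linarith)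
  have h2 : (L₂ * (L - μ)) ^ 2 < (2 * μ * L * √((r : ℝ) / rs)) ^ 2 := by gcongr
  rw [mul_pow _ (√_), Real.sq_sqrt (by positivity)] at h2
  calc _ < (2 * μ * L) ^ 2 * (r / rs) * rs := by gcongr
    _ = _ := by field_simp; ring

/-- The scalar part of `eq_of_core_inequality`. There a = ‖A(1-R)‖², b = ‖AR‖², c = ‖M‖², d = ⟨A,
M⟩, e = ⟨N, M⟩, f = ‖N‖², ν = ‖NR‖², p = tr(PR), q = tr R. The value of κ makes 2μLκ = μ + L, so
that e4 absorbs all terms containing M. -/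
lemma core_scalar_contradiction {r rs : ℕ} (hrs : 1 ≤ rs) (hr : rs ≤ r) {μ L L₂ s : ℝ} (hμ : 0 < μ)
    (hμL : μ ≤ L) (hs : 0 < s) (hgap : (L₂ * (L - μ)) ^ 2 * rs < 4 * μ ^ 2 * L ^ 2 * r)
    {a b c d e f κ ν p q : ℝ} (hp : 0 ≤ p) (hq : q ≤ rs) (hκ : κ = (μ + L) / (2 * (μ * L)))
    (hν : 0 < ν) (e1 : s ^ 2 * (r - p) ≤ a) (e2 : ν ≤ (L₂ * s) ^ 2 * (q - p))
    (e3 : ν ≤ f) (e4 : c - 2 * (d + κ * e) ≥ -(b + κ ^ 2 * ν))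
    (h : f + μ * L * (b + a - 2 * d + c) ≤ (μ + L) * e) : False := by
  have hL : 0 < L := hμ.trans_le hμL
  have hκ' : 2 * (μ * L) * κ = μ + L := by rw [hκ]; field_simp
  have hκ2 : 4 * (μ * L) * (μ * L * κ ^ 2) = (μ + L) ^ 2 := by
    rw [← hκ']; ring
  have hμL' : 0 < μ * L := mul_pos hμ hL
  have e6 : ν + μ * L * (a - κ ^ 2 * ν) ≤ 0 := by
    have h6 : μ * L * (c - 2 * (d + κ * e)) ≥ μ * L * -(b + κ ^ 2 * ν) :=
      mul_le_mul_of_nonneg_left e4 hμL'.le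
    have h7 : 2 * (μ * L) * κ * e = (μ + L) * e := by rw [hκ']
    linarith
  -- The coefficient on the right is (μ+L)² - 4μL.
  have e7 : 4 * (μ * L) ^ 2 * a ≤ (L - μ) ^ 2 * ν := by
    have : 4 * (μ * L) * (ν + μ * L * (a - κ ^ 2 * ν)) ≤ 0 :=
      mul_nonpos_of_nonneg_of_nonpos (by positivity) e6
    have h8 : 4 * (μ * L) * (ν + μ * L * (a - κ ^ 2 * ν)) =
      4 * (μ * L) * ν + 4 * (μ * L) ^ 2 * a - (4 * (μ * L) * (μ * L * κ ^ 2)) * ν := by ring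
    rw [h8, hκ2] at this
    linarith
  have e8 : 4 * (μ * L) ^ 2 * (s ^ 2 * (r - p)) ≤ (L - μ) ^ 2 * ((L₂ * s) ^ 2 * (q - p)) :=
    calc _ ≤ 4 * (μ * L) ^ 2 * a := by gcongr
      _ ≤ (L - μ) ^ 2 * ν := e7
      _ ≤ _ := by gcongr
  have hqp : 0 < q - p := by
    by_contra hc
    have : (L₂ * s) ^ 2 * (q - p) ≤ 0 :=
      mul_nonpos_of_nonneg_of_nonpos (by positivity) (not_lt.mp hc)
    linarith
  have e9 : 4 * (μ * L) ^ 2 * (r - p) ≤ (L₂ * (L - μ)) ^ 2 * (q - p) := by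
    have hs2 : 0 < s ^ 2 := by positivity
    refine le_of_mul_le_mul_left ?_ hs2
    linarith
  have hrs' : (0 : ℝ) < rs := by exact_mod_cast hrs
  have hr' : (rs : ℝ) ≤ r := by exact_mod_cast hr
  -- Since p < q ≤ rs, the strict gap can be multiplied by rs - p. The outcome (r-p)·rs < r·(rs-p)
  -- amounts to p·r < p·rs.
  have e10 : 4 * (μ * L) ^ 2 * ((r - p) * rs) < 4 * (μ * L) ^ 2 * (r * (rs - p)) :=
    calc 4 * (μ * L) ^ 2 * ((r - p) * rs) = 4 * (μ * L) ^ 2 * (r - p) * rs := by ring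
      _ ≤ (L₂ * (L - μ)) ^ 2 * (q - p) * rs := by gcongr
      _ ≤ (L₂ * (L - μ)) ^ 2 * (rs - p) * rs := by gcongr
      _ = (L₂ * (L - μ)) ^ 2 * rs * (rs - p) := by ring
      _ < 4 * μ ^ 2 * L ^ 2 * r * (rs - p) := by
        apply mul_lt_mul_of_pos_right hgap; linarith
      _ = _ := by ring
  have e11 := lt_of_mul_lt_mul_left e10 (by positivity)
  linarith [mul_le_mul_of_nonneg_left hr' hp]

/-- The inequality at the heart of the landscape analysis. -/
theorem eq_of_core_inequality {n : Type*} [Fintype n] [DecidableEq n] {r rs : ℕ} (hrs : 1 ≤ rs)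
    (hr : rs ≤ r) {μ L L₂ s : ℝ} (hμ : 0 < μ) (hμL : μ ≤ L) (hL₂ : 0 ≤ L₂) (hs : 0 ≤ s)
    (hgap : L₂ < μ * (2 * √((r : ℝ) / rs) + L₂ / L))
    (U : Matrix n (Fin r) ℝ) (hU : ∀ w, s * (w ⬝ᵥ w) ≤ (U *ᵥ w) ⬝ᵥ (U *ᵥ w))
    (M N R : Matrix n n ℝ) (hN : Nᵀ = N) (hNU : N * U = 0)
    (hNτ : ∀ x, (N *ᵥ x) ⬝ᵥ (N *ᵥ x) ≤ (L₂ * s) ^ 2 * (x ⬝ᵥ x))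
    (hR : IsOrthProj R) (hRt : R.trace ≤ rs) (hM : Mᵀ = M) (hRM : R * M = M)
    (h : trForm N N + μ * L * trForm (U * Uᵀ - M) (U * Uᵀ - M) ≤ (μ + L) * trForm N M) :
    U * Uᵀ = M := by
  have hL : 0 < L := hμ.trans_le hμL
  have conclude : trForm N M = 0 → U * Uᵀ = M := by
    intro h0
    rw [h0, mul_zero] at h
    have h1 : trForm (U * Uᵀ - M) (U * Uᵀ - M) = 0 := by
      refine le_antisymm ?_ (trForm_self_nonneg _)
      by_contra hc
      have := mul_pos (mul_pos hμ hL) (not_le.mp hc)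
      linarith [trForm_self_nonneg N]
    exact sub_eq_zero.mp (trForm_self_eq_zero.mp h1)
  have hMR : M * R = M := by
    have := congrArg transpose hRM
    rwa [transpose_mul, hM, hR.1] at this
  -- As M = MR, the case NR = 0 gives ⟨N, M⟩ = 0 and the inequality itself forces UUᵀ = M; the other
  -- case is contradictory.
  by_cases hNR : N * R = 0
  · apply conclude
    rw [← hMR, trForm_comm, trForm_mul_right, hR.1, hNR]
    simp
  exfalso
  have hNRpos : 0 < trForm (N * R) (N * R) :=
    lt_of_le_of_ne (trForm_self_nonneg _) fun h0 => hNR (trForm_self_eq_zero.mp h0.symm)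
  have hs' : 0 < s := by
    rcases hs.eq_or_lt with h0 | h0
    · have : trForm (N * R) (N * R) ≤ (L₂ * s) ^ 2 * trForm (1 * R) (1 * R) :=
        trForm_self_mul_le (by simpa using hNτ) R
      rw [← h0] at this
      simp at this
      linarith
    · exact h0
  obtain ⟨P, hP, hPU, hPt, hPN, hPx⟩ := exists_range_projection U hs' hU
  have hNP := hPN N hNU
  set A := U * Uᵀ with hA
  have hAt : Aᵀ = A := by simp [hA]
  have hUN : Uᵀ * N = 0 := by
    have := congrArg transpose hNU
    rwa [transpose_mul, hN, transpose_zero] at this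
  set p := trForm P R with hp
  have hp0 : 0 ≤ p := by rw [hp, ← hP.trForm_mul_self hR]; exact trForm_self_nonneg _
  have htr : ∀ {B : Matrix n n ℝ}, trForm 1 B = B.trace := by intro B; simp [trForm]
  -- A is bounded below by s on the range of P, so s‖P(1-R)‖ ≤ ‖A(1-R)‖; and ‖P(1-R)‖² = tr P -
  -- tr(PR) with tr P = r.
  have e1 : s ^ 2 * (r - p) ≤ trForm (A * (1 - R)) (A * (1 - R)) := by
    have h1 : s ^ 2 * trForm (P * (1 - R)) (P * (1 - R)) ≤ trForm (A * (1 - R)) (A * (1 - R)) := by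
      have : trForm (P * (1 - R)) (P * (1 - R)) ≤
          (s ^ 2)⁻¹ * trForm (A * (1 - R)) (A * (1 - R)) := by
        refine trForm_self_mul_le (fun x => ?_) _
        rw [inv_mul_eq_div, le_div_iff₀ (by positivity), mul_comm]
        exact hPx x
      rwa [inv_mul_eq_div, le_div_iff₀ (by positivity), mul_comm] at this
    rwa [hP.trForm_mul_self hR.one_sub, trForm_sub_right, trForm_comm, htr, hPt,
      Fintype.card_fin, ← hp] at h1
  -- N kills the range of P, so NR = N(1-P)R, and ‖(1-P)R‖² = tr R - p.
  have e2 : trForm (N * R) (N * R) ≤ (L₂ * s) ^ 2 * (R.trace - p) := by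
    have hN1 : N = N * (1 - P) := by rw [Matrix.mul_sub, hNP]; simp
    have : trForm (N * R) (N * R) ≤ (L₂ * s) ^ 2 * trForm ((1 - P) * R) ((1 - P) * R) := by
      refine trForm_self_mul_le (fun x => ?_) _
      have := hNτ ((1 - P) *ᵥ x)
      rwa [Matrix.mulVec_mulVec, ← hN1] at this
    rwa [hP.one_sub.trForm_mul_self hR, trForm_sub_left, htr, ← hp] at this
  have e3 : trForm (N * R) (N * R) ≤ trForm N N := by
    rw [hR.trForm_self_split N]; linarith [trForm_self_nonneg (N * (1 - R))]
  set κ := (μ + L) / (2 * (μ * L)) with hκ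
  -- Completing the square: ‖M - RKR‖² ≥ 0 with K = A + κN and ‖RKR‖ ≤ ‖KR‖. The cross term of ‖KR‖²
  -- vanishes because AN = 0.
  have e4 : trForm M M - 2 * trForm (A + κ • N) M ≥
      -(trForm (A * R) (A * R) + κ ^ 2 * trForm (N * R) (N * R)) := by
    set K := A + κ • N with hK
    have h1 := trForm_self_nonneg (M - R * (K * R))
    have h2 : trForm (R * (K * R)) M = trForm K M := by
      rw [trForm_mul_left, hR.1, hRM, trForm_mul_right, hR.1, hMR]
    have h3 := hR.trForm_mul_left_le (K * R)
    have h4 : trForm (K * R) (K * R) =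
        trForm (A * R) (A * R) + κ ^ 2 * trForm (N * R) (N * R) := by
      have h5 : trForm (A * R) (N * R) = 0 := by
        rw [trForm_mul_left, hAt, hA, Matrix.mul_assoc, ← Matrix.mul_assoc Uᵀ, hUN]
        simp
      rw [hK, Matrix.add_mul, Matrix.smul_mul, trForm_add_left, trForm_add_right, trForm_add_right,
        trForm_smul_left, trForm_smul_right, trForm_smul_right, trForm_smul_left,
        trForm_comm (N * R) (A * R), h5]
      ring
    rw [trForm_sub_left, trForm_sub_right, trForm_sub_right, trForm_comm M (R * (K * R)), h2] at h1
    linarith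
  have e5 := hR.trForm_self_split A
  rw [trForm_sub_left, trForm_sub_right, trForm_sub_right, trForm_comm M A] at h
  rw [trForm_add_left, trForm_smul_left] at e4
  rw [e5] at h
  exact core_scalar_contradiction hrs hr hμ hμL hs' (scalar_gap hrs hμ hμL hL₂ hgap) hp0 hRt hκ
    hNRpos e1 e2 e3 e4 (by linarith)

end Core

/-! ### From critical points to the core inequality. -/

section Reductions

lemma matrix_rank_add_le {m n : Type*} [Fintype m] [Fintype n] (A B : Matrix m n ℝ) :
    (A + B).rank ≤ A.rank + B.rank := by
  have h : LinearMap.range (A + B).mulVecLin ≤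
      LinearMap.range A.mulVecLin ⊔ LinearMap.range B.mulVecLin := by
    rintro _ ⟨x, rfl⟩
    rw [Matrix.mulVecLin_add]
    exact Submodule.add_mem_sup ⟨x, rfl⟩ ⟨x, rfl⟩
  exact (Submodule.finrank_mono h).trans (Submodule.finrank_add_le_finrank_add_finrank _ _)

/-- A common orthogonal projection for the column spaces of two matrices, of small rank. -/
lemma exists_projection_rank_le {n p q : Type*} [Fintype n] [DecidableEq n] [Fintype p] [Fintype q]
    (A : Matrix n p ℝ) (B : Matrix n q ℝ) :
    ∃ P : Matrix n n ℝ, IsOrthProj P ∧ P * A = A ∧ P * B = B ∧ P.rank ≤ A.rank + B.rank ∧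
      P.trace ≤ A.rank + B.rank := by
  have hS : (A * Aᵀ + B * Bᵀ)ᵀ = A * Aᵀ + B * Bᵀ := by simp
  obtain ⟨Q, e, hQ1, hQ2, hSe⟩ := exists_orthogonal_diagonal hS
  -- The indicator of the nonzero eigenvalues of AAᵀ + BBᵀ, whose range is the sum of the two column
  -- spaces.
  set f : n → ℝ := fun i => if e i = 0 then 0 else 1 with hf
  have hmul : ∀ f g : n → ℝ, (Q * diagonal f * Qᵀ) * (Q * diagonal g * Qᵀ) =
      Q * diagonal (fun i => f i * g i) * Qᵀ := by
    intro f g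
    rw [← diagonal_mul_diagonal]
    calc _ = Q * diagonal f * (Qᵀ * Q) * diagonal g * Qᵀ := by simp only [Matrix.mul_assoc]
      _ = _ := by rw [hQ1]; simp only [Matrix.mul_assoc, Matrix.one_mul]
  have hP : IsOrthProj (Q * diagonal f * Qᵀ) := by
    refine ⟨by simp [Matrix.transpose_mul, Matrix.mul_assoc], ?_⟩
    rw [hmul]
    congr 3
    ext i
    simp [hf]
  have hPS : (Q * diagonal f * Qᵀ) * (A * Aᵀ + B * Bᵀ) = A * Aᵀ + B * Bᵀ := by
    rw [hSe, hmul]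
    congr 3
    ext i
    by_cases h : e i = 0 <;> simp [hf, h]
  have hcard : Fintype.card {i // f i ≠ 0} ≤ A.rank + B.rank := by
    have h1 : Fintype.card {i // f i ≠ 0} = (diagonal e).rank := by
      rw [rank_diagonal]
      refine Fintype.card_congr (Equiv.subtypeEquivRight fun i => ?_)
      by_cases h : e i = 0 <;> simp [hf, h]
    have h2 : diagonal e = Qᵀ * (A * Aᵀ + B * Bᵀ) * Q := by
      rw [hSe]
      calc diagonal e = (Qᵀ * Q) * diagonal e * (Qᵀ * Q) := by rw [hQ1]; simp
        _ = _ := by simp only [Matrix.mul_assoc]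
    rw [h1, h2]
    calc _ ≤ (A * Aᵀ + B * Bᵀ).rank :=
          (rank_mul_le_left _ _).trans (rank_mul_le_right _ _)
      _ ≤ (A * Aᵀ).rank + (B * Bᵀ).rank := matrix_rank_add_le _ _
      _ ≤ _ := add_le_add (rank_mul_le_left _ _) (rank_mul_le_left _ _)
  -- The sum pairs 1 - P with (1-P)(AAᵀ + BBᵀ) = 0. Both terms are squared norms, so each vanishes.
  have hfix : trForm ((1 - Q * diagonal f * Qᵀ) * A) ((1 - Q * diagonal f * Qᵀ) * A) +
      trForm ((1 - Q * diagonal f * Qᵀ) * B) ((1 - Q * diagonal f * Qᵀ) * B) = 0 := by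
    set P := Q * diagonal f * Qᵀ
    rw [trForm_mul_right, trForm_mul_right, ← trForm_add_right, Matrix.mul_assoc, Matrix.mul_assoc,
      ← Matrix.mul_add, Matrix.sub_mul, hPS]
    simp
  have hA := trForm_self_nonneg ((1 - Q * diagonal f * Qᵀ) * A)
  have hB := trForm_self_nonneg ((1 - Q * diagonal f * Qᵀ) * B)
  refine ⟨Q * diagonal f * Qᵀ, hP, ?_, ?_, ?_, ?_⟩
  · have := trForm_self_eq_zero.mp (le_antisymm (by linarith) hA)
    rw [Matrix.sub_mul, Matrix.one_mul, sub_eq_zero] at this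
    exact this.symm
  · have := trForm_self_eq_zero.mp (le_antisymm (by linarith) hB)
    rw [Matrix.sub_mul, Matrix.one_mul, sub_eq_zero] at this
    exact this.symm
  · refine le_trans ((rank_mul_le_left _ _).trans (rank_mul_le_right _ _)) ?_
    rwa [rank_diagonal]
  · rw [Matrix.trace_mul_comm, ← Matrix.mul_assoc, hQ1, Matrix.one_mul, trace_diagonal]
    calc ∑ i, f i = Fintype.card {i // f i ≠ 0} := by
          rw [Fintype.card_subtype, Finset.card_filter]
          push_cast
          refine Finset.sum_congr rfl fun i _ => ?_
          by_cases h : e i = 0 <;> simp [hf, h]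
      _ ≤ _ := by exact_mod_cast hcard

/-- A unit vector in a minimal direction of `A`. -/
lemma exists_min_direction {m n : Type*} [Fintype m] [Fintype n] [DecidableEq n] [Nonempty n]
    (A : Matrix m n ℝ) :
    ∃ w : n → ℝ, w ⬝ᵥ w = 1 ∧
      ∀ v, ((A *ᵥ w) ⬝ᵥ (A *ᵥ w)) * (v ⬝ᵥ v) ≤ (A *ᵥ v) ⬝ᵥ (A *ᵥ v) := by
  obtain ⟨Q, e, hQ1, hQ2, hS⟩ := exists_orthogonal_diagonal (S := Aᵀ * A) (by simp)
  obtain ⟨i, hi⟩ := Finite.exists_min e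
  have key : ∀ v, (A *ᵥ v) ⬝ᵥ (A *ᵥ v) = ∑ j, e j * (Qᵀ *ᵥ v) j ^ 2 := by
    intro v
    rw [mulVec_dotProduct_mulVec, hS, dotProduct_mulVec_conj_diagonal]
  have hw : Qᵀ *ᵥ (Q *ᵥ Pi.single i 1) = Pi.single i 1 := by
    rw [Matrix.mulVec_mulVec, hQ1, one_mulVec]
  refine ⟨Q *ᵥ Pi.single i 1, ?_, fun v => ?_⟩
  · rw [mulVec_dotProduct_mulVec, hQ1]; simp
  · rw [key, key, hw]
    have hv : v ⬝ᵥ v = ∑ j, (Qᵀ *ᵥ v) j ^ 2 := by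
      have : v ⬝ᵥ v = (Qᵀ *ᵥ v) ⬝ᵥ (Qᵀ *ᵥ v) := by
        rw [mulVec_dotProduct_mulVec, transpose_transpose, hQ2, one_mulVec]
      rw [this, dotProduct]
      exact Finset.sum_congr rfl fun i _ => (sq _).symm
    have he : ∑ j, e j * (Pi.single i 1 : n → ℝ) j ^ 2 = e i := by
      simp [Pi.single_apply]
    rw [he, hv, Finset.mul_sum]
    exact Finset.sum_le_sum fun j _ => mul_le_mul_of_nonneg_right (hi j) (sq_nonneg _)

/-- A lower bound for a quadratic form on `a⊥` extends when `a` is in the kernel. -/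
lemma quadratic_lower_bound_of_orthogonal {n : Type*} [Fintype n] {S : Matrix n n ℝ} (hS : Sᵀ = S)
    {a : n → ℝ} (hSa : S *ᵥ a = 0) {τ : ℝ} (hτ : 0 ≤ τ)
    (h : ∀ x, x ⬝ᵥ a = 0 → -τ * (x ⬝ᵥ x) ≤ x ⬝ᵥ (S *ᵥ x)) (x : n → ℝ) :
    -τ * (x ⬝ᵥ x) ≤ x ⬝ᵥ (S *ᵥ x) := by
  by_cases ha : a = 0
  · exact h x (by simp [ha])
  have ha' : a ⬝ᵥ a ≠ 0 := fun h0 => ha (dotProduct_self_eq_zero.mp h0)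
  set c := (x ⬝ᵥ a) / (a ⬝ᵥ a) with hc
  have hca : c * (a ⬝ᵥ a) = x ⬝ᵥ a := div_mul_cancel₀ _ ha'
  -- Removing the component along a leaves xᵀSx unchanged, as Sa = 0, and can only shorten x.
  have h1 := h (x - c • a) (by rw [sub_dotProduct, smul_dotProduct, smul_eq_mul, hca, sub_self])
  have h2 : S *ᵥ (x - c • a) = S *ᵥ x := by
    rw [Matrix.mulVec_sub, Matrix.mulVec_smul, hSa]; simp
  have h3 : a ⬝ᵥ (S *ᵥ x) = 0 := by
    rw [Matrix.dotProduct_mulVec, ← Matrix.mulVec_transpose, hS, hSa, zero_dotProduct]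
  rw [h2, sub_dotProduct x (c • a) (S *ᵥ x), smul_dotProduct, h3] at h1
  have h4 : (x - c • a) ⬝ᵥ (x - c • a) = x ⬝ᵥ x - c ^ 2 * (a ⬝ᵥ a) := by
    rw [sub_dotProduct, dotProduct_sub, dotProduct_sub, smul_dotProduct, dotProduct_smul,
      smul_dotProduct, dotProduct_smul, dotProduct_comm a x, ← hca]
    simp only [smul_eq_mul]; ring
  rw [h4] at h1
  have h5 : 0 ≤ τ * (c ^ 2 * (a ⬝ᵥ a)) := by
    have := dotProduct_self_nonneg' a
    positivity
  simp at h1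
  linarith

/-- Reduction of the landscape theorem to the core inequality by passing to the negative part of
the (compressed) dual matrix `S` of the critical point. -/
theorem eq_of_dual_matrices {n : Type*} [Fintype n] [DecidableEq n] {r rs : ℕ} (hrs : 1 ≤ rs)
    (hr : rs ≤ r) {μ L L₂ s : ℝ} (hμ : 0 < μ) (hμL : μ ≤ L) (hL₂ : 0 ≤ L₂) (hs : 0 ≤ s)
    (hgap : L₂ < μ * (2 * √((r : ℝ) / rs) + L₂ / L))
    (U : Matrix n (Fin r) ℝ) (hU : ∀ w, s * (w ⬝ᵥ w) ≤ (U *ᵥ w) ⬝ᵥ (U *ᵥ w))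
    (M S T P : Matrix n n ℝ) (hS : Sᵀ = S) (hSU : S * U = 0)
    (hlow : ∀ x, -(L₂ * s) * (x ⬝ᵥ x) ≤ x ⬝ᵥ (S *ᵥ x))
    (hT : T.PosSemidef) (hM : M.PosSemidef) (hMr : M.rank ≤ rs) (hTM : trForm T M ≤ 0)
    (hP : IsOrthProj P) (hPU : P * U = U) (hPM : P * M = M) {X : ℝ}
    (hX : ∀ N : Matrix n n ℝ, N.PosSemidef →
      trForm (P * (S - T) * P) N ≤ -trForm N N → trForm N N ≤ X)
    (h : X + μ * L * trForm (U * Uᵀ - M) (U * Uᵀ - M) ≤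
      (μ + L) * trForm (P * (S - T) * P) (U * Uᵀ - M)) :
    U * Uᵀ = M := by
  obtain ⟨R, hR, hRM, -, -, hRt⟩ := exists_projection_rank_le M (0 : Matrix n n ℝ)
  have hRt' : R.trace ≤ rs := by
    rw [rank_zero] at hRt
    have : (M.rank : ℝ) ≤ rs := by exact_mod_cast hMr
    simp at hRt
    linarith
  have hMt : Mᵀ = M := (posSemidef_iff_dotProduct.mp hM).1
  have hMP : M * P = M := by
    have := congrArg transpose hPM
    rwa [transpose_mul, hMt, hP.1] at this
  have hUP : Uᵀ * P = Uᵀ := by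
    have := congrArg transpose hPU
    rwa [transpose_mul, hP.1] at this
  have hSPt : (P * S * P)ᵀ = P * S * P := by
    simp [Matrix.transpose_mul, hP.1, hS, Matrix.mul_assoc]
  have hquad : ∀ x, x ⬝ᵥ ((P * S * P) *ᵥ x) = (P *ᵥ x) ⬝ᵥ (S *ᵥ (P *ᵥ x)) := by
    intro x
    rw [Matrix.mulVec_mulVec, mulVec_dotProduct_mulVec, hP.1, Matrix.mul_assoc]
  have hlow' : ∀ x, -(L₂ * s) * (x ⬝ᵥ x) ≤ x ⬝ᵥ ((P * S * P) *ᵥ x) := by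
    intro x
    rw [hquad]
    refine le_trans ?_ (hlow _)
    have h1 : (P *ᵥ x) ⬝ᵥ (P *ᵥ x) ≤ x ⬝ᵥ x := by
      have h2 : (P *ᵥ x) ⬝ᵥ (P *ᵥ x) + ((1 - P) *ᵥ x) ⬝ᵥ ((1 - P) *ᵥ x) = x ⬝ᵥ x := by
        rw [mulVec_dotProduct_mulVec, mulVec_dotProduct_mulVec, hP.1, hP.one_sub.1, hP.2,
          hP.one_sub.2, ← dotProduct_add, ← Matrix.add_mulVec]
        simp
      linarith [dotProduct_self_nonneg' ((1 - P) *ᵥ x)]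
    have : 0 ≤ L₂ * s := by positivity
    nlinarith
  obtain ⟨N, hN, hSN, hmul, hNτ⟩ := exists_neg_part hSPt (τ := L₂ * s) (by positivity) hlow'
  have hNt : Nᵀ = N := (posSemidef_iff_dotProduct.mp hN).1
  have hSPU : P * S * P * U = 0 := by
    rw [Matrix.mul_assoc, hPU, Matrix.mul_assoc, hSU, Matrix.mul_zero]
  have hNS : N * (P * S * P) = -(N * N) := by
    have := congrArg transpose hmul
    rwa [transpose_mul, hNt, hSPt, transpose_neg, transpose_mul, hNt] at this
  -- ‖NU‖² = ⟨U, N²U⟩, and N²U = -N(PSP)U = 0.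
  have hNU : N * U = 0 := by
    apply trForm_self_eq_zero.mp
    rw [trForm_mul_left, hNt, ← Matrix.mul_assoc, ← neg_neg (N * N), ← hNS, Matrix.neg_mul,
      Matrix.mul_assoc, hSPU]
    simp
  have hTP : (P * T * P).PosSemidef := by
    have := hT.mul_mul_conjTranspose_same P
    rwa [conjTranspose_eq_transpose_of_trivial, hP.1] at this
  have hD : P * (S - T) * P = P * S * P - P * T * P := by
    rw [Matrix.mul_sub, Matrix.sub_mul]
  have hSN' : trForm (P * S * P) N = -trForm N N := by
    rw [trForm, hSPt, hmul, trForm, hNt, trace_neg]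
  -- ⟨D, N⟩ = -‖N‖² - ⟨PTP, N⟩ ≤ -‖N‖². The bound X is kept abstract: it is ‖D‖² in the symmetric
  -- case, but only half the squared norm of the compression in the lifted asymmetric case.
  have hX' := hX N hN (by
    rw [hD, trForm_sub_left, hSN']
    linarith [trForm_nonneg_of_psd hTP hN])
  refine eq_of_core_inequality hrs hr hμ hμL hL₂ hs hgap U hU M N R hNt hNU hNτ hR hRt' hMt hRM ?_
  have hSUU : trForm (P * S * P) (U * Uᵀ) = 0 := by
    rw [trForm, hSPt, ← Matrix.mul_assoc, hSPU]; simp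
  have hTUU : 0 ≤ trForm (P * T * P) (U * Uᵀ) := by
    refine trForm_nonneg_of_psd hTP ?_
    rw [← conjTranspose_eq_transpose_of_trivial]
    exact posSemidef_self_mul_conjTranspose U
  have hTM' : trForm (P * T * P) M = trForm T M := by
    rw [trForm_mul_right, hP.1, hMP, trForm_mul_left, hP.1, hPM]
  have hpos := trForm_nonneg_of_psd hSN hM
  rw [trForm_add_left] at hpos
  -- The signs ⟨PSP, UUᵀ⟩ = 0, ⟨PTP, UUᵀ⟩ ≥ 0 and ⟨T, M⟩ ≤ 0 leave -⟨PSP, M⟩, which is at most ⟨N,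
  -- M⟩ since PSP + N ⪰ 0.
  have hle : trForm (P * (S - T) * P) (U * Uᵀ - M) ≤ trForm N M := by
    rw [hD, trForm_sub_left, trForm_sub_right, trForm_sub_right, hSUU, hTM']
    linarith
  have : (μ + L) * trForm (P * (S - T) * P) (U * Uᵀ - M) ≤ (μ + L) * trForm N M :=
    mul_le_mul_of_nonneg_left hle (by linarith)
  linarith

end Reductions

/-! ### Balancing two Gram matrices. -/

section Balancing

variable {n : Type*} [Fintype n] [DecidableEq n]

lemma exists_posDef_sqrt {A : Matrix n n ℝ} (hA : A.PosDef) :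
    ∃ R : Matrix n n ℝ, R.PosDef ∧ R * R = A := by
  have hAt : Aᵀ = A := (posSemidef_iff_dotProduct.mp hA.posSemidef).1
  obtain ⟨Q, e, hQ1, hQ2, hAe⟩ := exists_orthogonal_diagonal hAt
  have he : ∀ i, 0 ≤ e i := by
    intro i
    have := (posSemidef_iff_dotProduct.mp hA.posSemidef).2 (Q *ᵥ Pi.single i 1)
    rw [hAe, dotProduct_mulVec_conj_diagonal, Matrix.mulVec_mulVec, hQ1] at this
    simpa [Matrix.one_apply, Pi.single_apply, Finset.sum_ite_eq] using this
  have hsq : (Q * diagonal (fun i => √(e i)) * Qᵀ) * (Q * diagonal (fun i => √(e i)) * Qᵀ) = A := by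
    have h1 : diagonal e = diagonal (fun i => √(e i)) * diagonal (fun i => √(e i)) := by
      rw [diagonal_mul_diagonal]
      congr 1
      ext i
      exact (Real.mul_self_sqrt (he i)).symm
    rw [hAe, h1]
    calc _ = Q * diagonal (fun i => √(e i)) * (Qᵀ * Q) * diagonal (fun i => √(e i)) * Qᵀ := by
          simp only [Matrix.mul_assoc]
      _ = _ := by rw [hQ1]; simp only [Matrix.mul_assoc, Matrix.one_mul]
  have hps := posSemidef_conj_diagonal Q (fun i => Real.sqrt_nonneg (e i))
  refine ⟨_, hps.posDef_iff_isUnit.mpr ?_, hsq⟩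
  have hu := hA.isUnit
  rw [← hsq, Matrix.isUnit_iff_isUnit_det, det_mul] at hu
  rw [Matrix.isUnit_iff_isUnit_det]
  exact isUnit_of_mul_isUnit_left hu

/-- Two positive definite matrices are balanced by a symmetric congruence (and its inverse). -/
lemma exists_balancing {A B : Matrix n n ℝ} (hA : A.PosDef) (hB : B.PosDef) :
    ∃ Q Q' : Matrix n n ℝ, Qᵀ = Q ∧ Q'ᵀ = Q' ∧ Q * Q' = 1 ∧ Q' * Q = 1 ∧
      Q * A * Q = Q' * B * Q' := by
  have conj : ∀ {X Y : Matrix n n ℝ}, X.PosDef → Y.PosDef → (X * Y * X).PosDef := by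
    intro X Y hX hY
    have hps : (X * Y * X).PosSemidef := by
      have := hY.posSemidef.mul_mul_conjTranspose_same X
      rwa [hX.1.eq] at this
    exact hps.posDef_iff_isUnit.mpr ((hX.isUnit.mul hY.isUnit).mul hX.isUnit)
  have sym : ∀ {X : Matrix n n ℝ}, X.PosDef → Xᵀ = X := fun hX =>
    (posSemidef_iff_dotProduct.mp hX.posSemidef).1
  obtain ⟨A₁, hA₁, hA₁A⟩ := exists_posDef_sqrt hA
  obtain ⟨C, hC, hCsq⟩ := exists_posDef_sqrt (conj hA₁ hB)
  -- Q² is the geometric mean of A⁻¹ and B, the positive definite solution of XAX = B; moving one Q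
  -- from each side across the equation gives the balance.
  obtain ⟨Q, hQ, hQsq⟩ := exists_posDef_sqrt (conj hA₁.inv hC)
  have det : ∀ {X : Matrix n n ℝ}, X.PosDef → IsUnit X.det := fun hX =>
    (Matrix.isUnit_iff_isUnit_det _).mp hX.isUnit
  have i1 := Matrix.mul_nonsing_inv _ (det hA₁)
  have i2 := Matrix.nonsing_inv_mul _ (det hA₁)
  have j1 := Matrix.mul_nonsing_inv _ (det hQ)
  have j2 := Matrix.nonsing_inv_mul _ (det hQ)
  refine ⟨Q, Q⁻¹, sym hQ, sym hQ.inv, j1, j2, ?_⟩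
  have key : (Q * Q) * A * (Q * Q) = B := by
    rw [hQsq, ← hA₁A]
    calc A₁⁻¹ * C * A₁⁻¹ * (A₁ * A₁) * (A₁⁻¹ * C * A₁⁻¹)
        = A₁⁻¹ * C * (A₁⁻¹ * A₁) * (A₁ * A₁⁻¹) * C * A₁⁻¹ := by simp only [Matrix.mul_assoc]
      _ = A₁⁻¹ * (C * C) * A₁⁻¹ := by
        rw [i1, i2]; simp only [Matrix.mul_assoc, Matrix.one_mul]
      _ = (A₁⁻¹ * A₁) * B * (A₁ * A₁⁻¹) := by rw [hCsq]; simp only [Matrix.mul_assoc]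
      _ = B := by rw [i1, i2]; simp
  rw [← key]
  calc Q * A * Q = (Q⁻¹ * Q) * Q * A * Q * (Q * Q⁻¹) := by rw [j1, j2]; simp
    _ = _ := by simp only [Matrix.mul_assoc]

end Balancing

/-! ### Restricted cocoercivity of the gradient. -/

section GradientLipschitz

/-- For a symmetric bilinear form with `μ|X|² ≤ H(X, X) ≤ L|X|²` on a subspace, the form
`H - (μ + L)/2` is bounded by `(L - μ)/2`. -/
lemma bilin_sub_mean_le {E : Type*} [NormedAddCommGroup E] [InnerProductSpace ℝ E]
    (H : E →L[ℝ] E →L[ℝ] ℝ) (hsymm : ∀ v w, H v w = H w v) (T : Submodule ℝ E) {μ L : ℝ}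
    (hlow : ∀ X ∈ T, μ * ‖X‖ ^ 2 ≤ H X X) (hup : ∀ X ∈ T, H X X ≤ L * ‖X‖ ^ 2)
    {D Y : E} (hD : D ∈ T) (hY : Y ∈ T) :
    H D Y - (μ + L) / 2 * inner ℝ D Y ≤ (L - μ) / 2 * (‖D‖ * ‖Y‖) := by
  by_cases hD0 : D = 0
  · simp [hD0]
  by_cases hY0 : Y = 0
  · simp [hY0]
  have hDn : 0 < ‖D‖ := norm_pos_iff.mpr hD0
  have hYn : 0 < ‖Y‖ := norm_pos_iff.mpr hY0
  -- D and Y are rescaled to equal norms, so that polarization, with the upper bound at A + B and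
  -- the lower one at A - B, yields the product ‖D‖‖Y‖.
  set A := ‖Y‖ • D
  set B := ‖D‖ • Y
  have hA : A ∈ T := T.smul_mem _ hD
  have hB : B ∈ T := T.smul_mem _ hY
  have h1 := hup _ (T.add_mem hA hB)
  have h2 := hlow _ (T.sub_mem hA hB)
  rw [@norm_add_sq ℝ] at h1
  rw [@norm_sub_sq ℝ] at h2
  have e1 : H (A + B) (A + B) = H A A + 2 * H A B + H B B := by
    simp only [map_add, _root_.add_apply, hsymm B A]; ring
  have e2 : H (A - B) (A - B) = H A A - 2 * H A B + H B B := by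
    simp only [map_sub, _root_.sub_apply, hsymm B A]; ring
  rw [e1] at h1
  rw [e2] at h2
  have nA : ‖A‖ = ‖Y‖ * ‖D‖ := by simp [A, norm_smul]
  have nB : ‖B‖ = ‖Y‖ * ‖D‖ := by simp [B, norm_smul, mul_comm]
  have iAB : inner ℝ A B = ‖Y‖ * ‖D‖ * inner ℝ D Y := by
    simp only [A, B, real_inner_smul_left, real_inner_smul_right]; ring
  have hAB : H A B = ‖Y‖ * ‖D‖ * H D Y := by
    simp only [A, B, map_smul, _root_.smul_apply, smul_eq_mul]; ring
  simp only [nA, nB, iAB, hAB, RCLike.re_to_real] at h1 h2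
  have hpos : 0 < ‖Y‖ * ‖D‖ := mul_pos hYn hDn
  refine le_of_mul_le_mul_left ?_ hpos
  linarith

/-- Restricted smoothness and strong convexity control the increment of the gradient. -/
theorem gradient_increment_le {E : Type*} [NormedAddCommGroup E] [InnerProductSpace ℝ E]
    {φ : E → ℝ} {s : Set E} (hs : Convex ℝ s) (hne : (interior s).Nonempty)
    (hφ : TwiceDifferentiableOn φ s) (T : Submodule ℝ E) {μ L : ℝ} {x y : E} (hx : x ∈ s)
    (hy : y ∈ s) (hT : y - x ∈ T)
    (hbd : ∀ z ∈ segment ℝ x y, ∀ X ∈ T,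
      μ * ‖X‖ ^ 2 ≤ hessForm φ s z X ∧ hessForm φ s z X ≤ L * ‖X‖ ^ 2)
    {Y : E} (hY : Y ∈ T) :
    fderivWithin ℝ φ s y Y - fderivWithin ℝ φ s x Y - (μ + L) / 2 * inner ℝ (y - x) Y ≤
      (L - μ) / 2 * (‖y - x‖ * ‖Y‖) := by
  set Φ := fderivWithin ℝ φ s with hΦ
  have hseg : ∀ t ∈ Icc (0 : ℝ) 1, x + t • (y - x) ∈ segment ℝ x y := by
    intro t ht
    rw [segment_eq_image']
    exact ⟨t, ht, rfl⟩
  have hmaps : MapsTo (fun t : ℝ => x + t • (y - x)) (Icc 0 1) s := fun t ht =>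
    hs.segment_subset hx hy (hseg t ht)
  have hline : ∀ t, HasDerivWithinAt (fun t : ℝ => x + t • (y - x)) (y - x) (Icc 0 1) t := by
    intro t
    have := ((hasDerivAt_id t).smul_const (y - x)).const_add x
    simpa using this.hasDerivWithinAt
  have hsymm : ∀ z ∈ s, ∀ v w, fderivWithin ℝ Φ s z v w = fderivWithin ℝ Φ s z w v := by
    intro z hz v w
    refine hs.second_derivative_within_at_symmetric hne (f := φ) (f' := Φ) (fun u hu => ?_) hz
      ((hφ.2 z hz).hasFDerivWithinAt.mono interior_subset) v w
    exact (hφ.1 u (interior_subset hu)).hasFDerivWithinAt.hasFDerivAt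
      (mem_interior_iff_mem_nhds.mp hu)
  have hder : ∀ t ∈ Icc (0 : ℝ) 1, HasDerivWithinAt (fun t : ℝ => Φ (x + t • (y - x)) Y)
      (fderivWithin ℝ Φ s (x + t • (y - x)) (y - x) Y) (Icc 0 1) t := by
    intro t ht
    have h1 := (hφ.2 _ (hmaps ht)).hasFDerivWithinAt.comp_hasDerivWithinAt t (hline t) hmaps
    exact (ContinuousLinearMap.apply ℝ ℝ Y).hasFDerivAt.comp_hasDerivWithinAt t h1
  -- For a fixed test direction Y the increment is a scalar function of t, so the mean value theorem
  -- suffices and the Hessian need not be continuous.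
  obtain ⟨t, ht, hslope⟩ := exists_hasDerivAt_eq_slope (fun t : ℝ => Φ (x + t • (y - x)) Y)
    (fun t => fderivWithin ℝ Φ s (x + t • (y - x)) (y - x) Y) zero_lt_one
    (fun t ht => (hder t ht).continuousWithinAt)
    (fun t ht => (hder t (Ioo_subset_Icc_self ht)).hasDerivAt (Icc_mem_nhds ht.1 ht.2))
  have ht' := Ioo_subset_Icc_self ht
  simp only [one_smul, add_sub_cancel, zero_smul, add_zero, sub_zero, div_one] at hslope
  rw [← hslope]
  exact bilin_sub_mean_le _ (hsymm _ (hmaps ht')) T (fun X hX => (hbd _ (hseg t ht') X hX).1)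
    (fun X hX => (hbd _ (hseg t ht') X hX).2) hT hY

/-- Cocoercivity-type inequality for the restriction `D` of the gradient increment to a subspace. -/
theorem restricted_cocoercivity {E : Type*} [NormedAddCommGroup E] [InnerProductSpace ℝ E]
    {φ : E → ℝ} {s : Set E} (hs : Convex ℝ s) (hne : (interior s).Nonempty)
    (hφ : TwiceDifferentiableOn φ s) (T : Submodule ℝ E) {μ L : ℝ} (hμL : μ ≤ L) {x y : E}
    (hx : x ∈ s) (hy : y ∈ s) (hT : y - x ∈ T)
    (hbd : ∀ z ∈ segment ℝ x y, ∀ X ∈ T,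
      μ * ‖X‖ ^ 2 ≤ hessForm φ s z X ∧ hessForm φ s z X ≤ L * ‖X‖ ^ 2)
    {D : E} (hD : D ∈ T)
    (hDφ : ∀ Y ∈ T, fderivWithin ℝ φ s y Y - fderivWithin ℝ φ s x Y = inner ℝ D Y) :
    inner ℝ D D + μ * L * inner ℝ (y - x) (y - x) ≤ (μ + L) * inner ℝ D (y - x) := by
  set Δ := y - x
  -- With this test direction the increment bound reads ‖Y‖² ≤ (L-μ)/2 · ‖Δ‖‖Y‖. Squaring ‖Y‖ ≤
  -- (L-μ)/2 · ‖Δ‖ then gives the claim, because ((μ+L)/2)² - ((L-μ)/2)² = μL.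
  set Y := D - ((μ + L) / 2) • Δ with hYdef
  have hY : Y ∈ T := T.sub_mem hD (T.smul_mem _ hT)
  have h := gradient_increment_le hs hne hφ T hx hy hT hbd hY
  rw [hDφ Y hY] at h
  have h1 : inner ℝ D Y - (μ + L) / 2 * inner ℝ Δ Y = ‖Y‖ ^ 2 := by
    rw [← real_inner_self_eq_norm_sq, ← real_inner_smul_left, ← inner_sub_left]
  rw [h1] at h
  have h2 : ‖Y‖ ≤ (L - μ) / 2 * ‖Δ‖ := by
    rcases (norm_nonneg Y).eq_or_lt with h0 | h0
    · rw [← h0]; exact mul_nonneg (by linarith) (norm_nonneg _)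
    · refine le_of_mul_le_mul_right ?_ h0
      linarith
  have h3 : ‖Y‖ ^ 2 ≤ ((L - μ) / 2 * ‖Δ‖) ^ 2 := by gcongr
  have h4 : ‖Y‖ ^ 2 = inner ℝ D D - (μ + L) * inner ℝ D Δ + ((μ + L) / 2) ^ 2 * inner ℝ Δ Δ := by
    rw [← real_inner_self_eq_norm_sq, hYdef, inner_sub_left, inner_sub_right, inner_sub_right,
      real_inner_smul_left, real_inner_smul_left, real_inner_smul_right, real_inner_smul_right,
      real_inner_comm D Δ]
    ring
  rw [h4, mul_pow, ← real_inner_self_eq_norm_sq] at h3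
  linarith

end GradientLipschitz

/-! ### Derivatives of the factored objectives. -/

section ChainRule

lemma hasFDerivAt_bilinear_diagonal {F G : Type*} [NormedAddCommGroup F] [NormedSpace ℝ F]
    [NormedAddCommGroup G] [NormedSpace ℝ G] (B : F →L[ℝ] F →L[ℝ] G) (u : F) :
    HasFDerivAt (fun u => B u u) (B u + B.flip u) u := by
  have := B.hasFDerivAt.clm_apply (hasFDerivAt_id u) (x := u)
  refine this.congr_fderiv ?_
  ext v
  simp

/-- First and second derivatives of `u ↦ φ(B(u, u)) + C(u, u)`, where `φ` is differentiated within
a set containing all the values `B(u, u)`. -/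
theorem derivatives_quadratic_composition {E F : Type*} [NormedAddCommGroup E] [NormedSpace ℝ E]
    [NormedAddCommGroup F] [NormedSpace ℝ F] {φ : E → ℝ} {s : Set E}
    (hφ : TwiceDifferentiableOn φ s) (B : F →L[ℝ] F →L[ℝ] E) (C : F →L[ℝ] F →L[ℝ] ℝ)
    (hB : ∀ u, B u u ∈ s) (f : F → ℝ) (hf : ∀ u, f u = φ (B u u) + C u u) (u v : F) :
    fderiv ℝ f u v = fderivWithin ℝ φ s (B u u) (B u v + B v u) + (C u v + C v u) ∧
    fderiv ℝ (fderiv ℝ f) u v v = hessForm φ s (B u u) (B u v + B v u) +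
      fderivWithin ℝ φ s (B u u) ((2 : ℝ) • B v v) + 2 * C v v := by
  set Φ := fderivWithin ℝ φ s with hΦ
  have h1 : ∀ u, HasFDerivAt f ((Φ (B u u)).comp (B u + B.flip u) + (C u + C.flip u)) u := by
    intro u
    have hfe : f = fun u => φ (B u u) + C u u := funext hf
    rw [hfe]
    refine HasFDerivAt.add ?_ (hasFDerivAt_bilinear_diagonal C u)
    -- All values B(u, u) lie in s, so the derivative within s yields an unrestricted derivative of
    -- the composite, even at boundary points of s.
    have := (hφ.1 _ (hB u)).hasFDerivWithinAt.comp (f := fun u => B u u) u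
      (hasFDerivAt_bilinear_diagonal B u).hasFDerivWithinAt (s := univ) (fun u _ => hB u)
    rwa [hasFDerivWithinAt_univ] at this
  have hfd : fderiv ℝ f = fun u => (Φ (B u u)).comp (B u + B.flip u) + (C u + C.flip u) :=
    funext fun u => (h1 u).fderiv
  refine ⟨by rw [hfd]; simp, ?_⟩
  have h2 : HasFDerivAt (fun u => Φ (B u u)) ((fderivWithin ℝ Φ s (B u u)).comp (B u + B.flip u))
      u := by
    have := (hφ.2 _ (hB u)).hasFDerivWithinAt.comp (f := fun u => B u u) u
      (hasFDerivAt_bilinear_diagonal B u).hasFDerivWithinAt (s := univ) (fun u _ => hB u)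
    rwa [hasFDerivWithinAt_univ] at this
  have h3 : HasFDerivAt (fun u => B u + B.flip u) (B + B.flip) u := (B + B.flip).hasFDerivAt
  have h4 : HasFDerivAt (fun u => C u + C.flip u) (C + C.flip) u := (C + C.flip).hasFDerivAt
  rw [hfd, ((h2.clm_comp h3).fun_add h4).fderiv]
  simp [hessForm, two_smul, ← hΦ]
  ring

/-- Version of `derivatives_quadratic_composition` for unbundled bilinear maps in finite dimension. -/
theorem derivatives_bilinear_composition {E F : Type*} [NormedAddCommGroup E] [NormedSpace ℝ E]
    [FiniteDimensional ℝ E] [NormedAddCommGroup F] [NormedSpace ℝ F] [FiniteDimensional ℝ F]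
    {φ : E → ℝ} {s : Set E} (hφ : TwiceDifferentiableOn φ s) {B : F → F → E}
    (hB : IsBilinearMap ℝ B) {C : F → F → ℝ} (hC : IsBilinearMap ℝ C)
    (hBs : ∀ u, B u u ∈ s) {f : F → ℝ} (hf : ∀ u, f u = φ (B u u) + C u u) (u v : F) :
    fderiv ℝ f u v = fderivWithin ℝ φ s (B u u) (B u v + B v u) + (C u v + C v u) ∧
    fderiv ℝ (fderiv ℝ f) u v v = hessForm φ s (B u u) (B u v + B v u) +
      fderivWithin ℝ φ s (B u u) ((2 : ℝ) • B v v) + 2 * C v v :=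
  derivatives_quadratic_composition hφ hB.toContinuousBilinearMap hC.toContinuousBilinearMap
    hBs f hf u v

end ChainRule

/-! ### The optimal constants are themselves admissible. -/

section Constants

variable {E : Type*} [NormedAddCommGroup E] [NormedSpace ℝ E]

/-- The optimal constants, as soon as there are admissible points and nonzero directions. -/
theorem LandscapeCondition.exists_constants {rk : E → ℕ} {s : Set E} {φ : E → ℝ} {r rs : ℕ}
    (hrs : 1 ≤ rs) (hr : rs ≤ r) (h : LandscapeCondition rk s φ r rs) {x X : E} (hx : x ∈ s)
    (hxr : rk x ≤ r + rs) (hX : X ≠ 0) (hXr : rk X ≤ r + rs) :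
    ∃ μ L L₂ : ℝ, 0 < μ ∧ μ ≤ L ∧ 0 ≤ L₂ ∧ L₂ < μ * (2 * √((r : ℝ) / rs) + L₂ / L) ∧
      TwiceDifferentiableOn φ s ∧
      (∀ M ∈ s, rk M ≤ r + rs → ∀ Y, rk Y ≤ r + rs →
        μ * ‖Y‖ ^ 2 ≤ hessForm φ s M Y ∧ hessForm φ s M Y ≤ L * ‖Y‖ ^ 2) ∧
      (∀ M ∈ s, rk M ≤ r + rs → ∀ Y, rk Y ≤ 2 → hessForm φ s M Y ≤ L₂ * ‖Y‖ ^ 2) := by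
  obtain ⟨-, ⟨μ₀, L₀, h₀⟩, hgap⟩ := h
  set μ := optMu rk s φ (r + rs) (r + rs)
  set L := optL rk s φ (r + rs) (r + rs)
  set L₂ := optL rk s φ 2 (r + rs)
  have h₂ : IsRSCS rk s φ 2 (r + rs) μ₀ L₀ :=
    ⟨h₀.1, h₀.2.1, h₀.2.2.1, fun M hM hMr Y hY => h₀.2.2.2 M hM hMr Y (hY.trans (by omega))⟩
  have hz : ∀ M, hessForm φ s M 0 = 0 := fun M => by simp [hessForm]
  have hμ : ∀ M ∈ s, rk M ≤ r + rs → ∀ Y, rk Y ≤ r + rs → μ * ‖Y‖ ^ 2 ≤ hessForm φ s M Y := by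
    intro M hM hMr Y hY
    by_cases hY0 : Y = 0
    · simp [hY0, hz]
    have hYn : 0 < ‖Y‖ ^ 2 := by positivity
    rw [← le_div_iff₀ hYn]
    -- Every admissible constant is below each Rayleigh quotient of the Hessian, hence so is the
    -- supremum.
    refine csSup_le ⟨μ₀, L₀, h₀⟩ ?_
    rintro m ⟨L', h'⟩
    rw [le_div_iff₀ hYn]
    exact (h'.2.2.2 M hM hMr Y hY).1
  have hLgen : ∀ k, (∃ m l, IsRSCS rk s φ k (r + rs) m l) → ∀ M ∈ s, rk M ≤ r + rs → ∀ Y,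
      rk Y ≤ k → hessForm φ s M Y ≤ optL rk s φ k (r + rs) * ‖Y‖ ^ 2 := by
    rintro k ⟨m, l, hml⟩ M hM hMr Y hY
    by_cases hY0 : Y = 0
    · simp [hY0, hz]
    have hYn : 0 < ‖Y‖ ^ 2 := by positivity
    rw [← div_le_iff₀ hYn]
    refine le_csInf ⟨l, m, hml⟩ ?_
    rintro l' ⟨m', h'⟩
    rw [div_le_iff₀ hYn]
    exact (h'.2.2.2 M hM hMr Y hY).2
  have hL := hLgen (r + rs) ⟨μ₀, L₀, h₀⟩
  have hL2 := hLgen 2 ⟨μ₀, L₀, h₂⟩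
  have hnn : ∀ k, 0 ≤ optL rk s φ k (r + rs) := fun k =>
    Real.sInf_nonneg fun l ⟨m, hm⟩ => hm.1.trans hm.2.1
  have hXn : 0 < ‖X‖ ^ 2 := by positivity
  have hμL : μ ≤ L := by
    refine le_of_mul_le_mul_right ?_ hXn
    exact (hμ x hx hxr X hXr).trans (hL x hx hxr X hXr)
  have hden : 0 < 2 * √((r : ℝ) / rs) + L₂ / L := by
    have h1 : (0 : ℝ) < rs := by exact_mod_cast hrs
    have h2 : (0 : ℝ) < r := by exact_mod_cast hrs.trans hr
    have h3 : 0 < √((r : ℝ) / rs) := Real.sqrt_pos.mpr (by positivity)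
    have h4 : 0 ≤ L₂ / L := div_nonneg (hnn 2) (hnn _)
    linarith
  refine ⟨μ, L, L₂, ?_, hμL, hnn 2, ?_, h₀.2.2.1, fun M hM hMr Y hY =>
    ⟨hμ M hM hMr Y hY, hL M hM hMr Y hY⟩, hL2⟩
  · exact lt_of_le_of_lt (div_nonneg (hnn 2) hden.le) hgap
  · exact (div_lt_iff₀ hden).mp hgap

end Constants

/-! ### Rank-one matrices. -/

section RankOne

variable {m n : Type*} [Fintype m] [Fintype n]

lemma trForm_vecMulVec (A : Matrix m n ℝ) (x : m → ℝ) (y : n → ℝ) :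
    trForm A (vecMulVec x y) = x ⬝ᵥ (A *ᵥ y) := by
  simp only [trForm_eq_sum, vecMulVec_apply, dotProduct, mulVec, Finset.mul_sum]
  exact Finset.sum_congr rfl fun i _ => Finset.sum_congr rfl fun j _ => by ring

lemma trForm_vecMulVec_vecMulVec (a x : m → ℝ) (b y : n → ℝ) :
    trForm (vecMulVec a b) (vecMulVec x y) = (a ⬝ᵥ x) * (b ⬝ᵥ y) := by
  rw [trForm_vecMulVec, vecMulVec_mulVec]
  simp [dotProduct_comm, mul_comm]

end RankOne

/-! ### The symmetric case. -/

lemma inner_eq_trForm {m n : ℕ} (A B : Matrix (Fin m) (Fin n) ℝ) : inner ℝ A B = trForm A B := rfl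

lemma norm_sq_eq_trForm {m n : ℕ} (A : Matrix (Fin m) (Fin n) ℝ) : ‖A‖ ^ 2 = trForm A A := by
  rw [← inner_eq_trForm, real_inner_self_eq_norm_sq]

lemma symMat_inner_eq_trForm {d : ℕ} (A B : SymMat d) :
    inner ℝ A B = trForm (A : Matrix (Fin d) (Fin d) ℝ) (B : Matrix (Fin d) (Fin d) ℝ) := rfl

lemma symMat_norm_sq_eq_trForm {d : ℕ} (A : SymMat d) :
    ‖A‖ ^ 2 = trForm (A : Matrix (Fin d) (Fin d) ℝ) (A : Matrix (Fin d) (Fin d) ℝ) := by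
  rw [← symMat_inner_eq_trForm, real_inner_self_eq_norm_sq]

lemma inner_gradientWithin {E : Type*} [NormedAddCommGroup E] [InnerProductSpace ℝ E]
    [CompleteSpace E] (φ : E → ℝ) (s : Set E) (x v : E) :
    inner ℝ (gradientWithin φ s x) v = fderivWithin ℝ φ s x v := by
  rw [gradientWithin, InnerProductSpace.toDual_symm_apply]

/-- The open unit Frobenius ball about the identity lies in the cone, since |xᵀDx| ≤ ‖D‖|x|².
Nonempty interior is what makes second derivatives within the cone symmetric. -/
lemma psdCone_interior_nonempty (d : ℕ) : (interior (psdCone d)).Nonempty := by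
  refine ⟨⟨1, Matrix.isSymm_one⟩, mem_interior_iff_mem_nhds.mpr ?_⟩
  refine Filter.mem_of_superset (Metric.ball_mem_nhds _ zero_lt_one) fun A hA => ?_
  rw [Metric.mem_ball, dist_eq_norm] at hA
  set D : Matrix (Fin d) (Fin d) ℝ := (A : Matrix (Fin d) (Fin d) ℝ) - 1 with hD
  have hDn : ‖D‖ < 1 := hA
  refine posSemidef_iff_dotProduct.mpr ⟨A.2, fun x => ?_⟩
  have h1 : x ⬝ᵥ ((A : Matrix (Fin d) (Fin d) ℝ) *ᵥ x) = x ⬝ᵥ x + trForm D (vecMulVec x x) := by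
    rw [trForm_vecMulVec, hD, Matrix.sub_mulVec, dotProduct_sub, one_mulVec]; ring
  have h2 := neg_le_of_abs_le (abs_real_inner_le_norm D (vecMulVec x x))
  have hx := dotProduct_self_nonneg' x
  have h3 : ‖vecMulVec x x‖ = x ⬝ᵥ x := by
    rw [← abs_of_nonneg hx, ← abs_of_nonneg (norm_nonneg (vecMulVec x x)), ← sq_eq_sq_iff_abs_eq_abs,
      norm_sq_eq_trForm, trForm_vecMulVec_vecMulVec, sq]
  rw [h3, inner_eq_trForm] at h2
  rw [h1]
  nlinarith

/-- The matrices supported on the range of a projection. -/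
def symSupported {d : ℕ} (P : Matrix (Fin d) (Fin d) ℝ) : Submodule ℝ (SymMat d) where
  carrier := {Y | P * (Y : Matrix (Fin d) (Fin d) ℝ) * P = Y}
  add_mem' {a b} ha hb := by
    simp only [mem_ofPred_eq, Submodule.coe_add, Matrix.mul_add, Matrix.add_mul] at *
    rw [ha, hb]
  zero_mem' := by simp
  smul_mem' c x hx := by
    simp only [mem_ofPred_eq, Submodule.coe_smul, Matrix.mul_smul, Matrix.smul_mul] at *
    rw [hx]

/-- The symmetrized product `(U Vᵀ + V Uᵀ) / 2`. -/
noncomputable def symProduct {d r : ℕ} (U V : Matrix (Fin d) (Fin r) ℝ) : SymMat d :=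
  ⟨(1 / 2 : ℝ) • (U * Vᵀ + V * Uᵀ),
    show ((1 / 2 : ℝ) • (U * Vᵀ + V * Uᵀ))ᵀ = _ by simp [add_comm]⟩

lemma coe_symProduct {d r : ℕ} (U V : Matrix (Fin d) (Fin r) ℝ) :
    ((symProduct U V : SymMat d) : Matrix (Fin d) (Fin d) ℝ) =
      (1 / 2 : ℝ) • (U * Vᵀ + V * Uᵀ) := rfl

lemma isBilinearMap_symProduct (d r : ℕ) :
    IsBilinearMap ℝ (symProduct : Matrix (Fin d) (Fin r) ℝ → Matrix (Fin d) (Fin r) ℝ → _) where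
  add_left U U' V := Subtype.ext (by
    simp only [Submodule.coe_add, coe_symProduct, transpose_add, Matrix.add_mul, Matrix.mul_add]
    module)
  smul_left c U V := Subtype.ext (by
    simp only [Submodule.coe_smul, coe_symProduct, transpose_smul, Matrix.smul_mul, Matrix.mul_smul]
    module)
  add_right U V V' := Subtype.ext (by
    simp only [Submodule.coe_add, coe_symProduct, transpose_add, Matrix.add_mul, Matrix.mul_add]
    module)
  smul_right c U V := Subtype.ext (by
    simp only [Submodule.coe_smul, coe_symProduct, transpose_smul, Matrix.smul_mul, Matrix.mul_smul]
    module)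

lemma isBilinearMap_smul_trForm {m n : Type*} [Fintype m] [Fintype n] (c : ℝ) :
    IsBilinearMap ℝ (fun A B : Matrix m n ℝ => c * trForm A B) where
  add_left A B C := by simp only [trForm_add_left]; ring
  smul_left a A B := by simp only [trForm_smul_left, smul_eq_mul]; ring
  add_right A B C := by simp only [trForm_add_right]; ring
  smul_right a A B := by simp only [trForm_smul_right, smul_eq_mul]; ring

lemma symFactor_mem_psdCone {d r : ℕ} (U : Matrix (Fin d) (Fin r) ℝ) :
    symFactor U ∈ psdCone d := by
  change (U * Uᵀ).PosSemidef
  rw [← conjTranspose_eq_transpose_of_trivial]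
  exact posSemidef_self_mul_conjTranspose U

/-- Second-order criticality for the symmetric factored objective, in matrix terms. -/
theorem symObjective_critical {d r : ℕ} {φ : SymMat d → ℝ}
    (hφ : TwiceDifferentiableOn φ (psdCone d)) {lam : ℝ} {U : Matrix (Fin d) (Fin r) ℝ}
    (hU : IsSecondOrderCritical (symObjective r φ lam) U) {S : Matrix (Fin d) (Fin d) ℝ}
    (hS : S = (gradientWithin φ (psdCone d) (symFactor U) : SymMat d).1 + lam • 1) :
    S * U = 0 ∧ ∀ (V : Matrix (Fin d) (Fin r) ℝ) (Y : SymMat d), Y.1 = U * Vᵀ + V * Uᵀ →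
      0 ≤ hessForm φ (psdCone d) (symFactor U) Y + 2 * trForm S (V * Vᵀ) := by
  set g : SymMat d := gradientWithin φ (psdCone d) (symFactor U) with hg
  have hdiag : ∀ V : Matrix (Fin d) (Fin r) ℝ, symProduct V V = symFactor V := by
    intro V
    refine Subtype.ext ?_
    rw [coe_symProduct, ← two_smul ℝ, smul_smul]
    simp [symFactor]
  have key := derivatives_bilinear_composition hφ (isBilinearMap_symProduct d r)
    (isBilinearMap_smul_trForm lam) (fun V => by
      rw [hdiag]
      exact symFactor_mem_psdCone V)
    (f := symObjective r φ lam) (fun V => by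
      rw [hdiag, symObjective, norm_sq_eq_trForm]) U
  simp only [hdiag, ← inner_gradientWithin φ (psdCone d), symMat_inner_eq_trForm, ← hg] at key
  have hsum : ∀ V : Matrix (Fin d) (Fin r) ℝ,
      (symProduct U V + symProduct V U : SymMat d).1 = U * Vᵀ + V * Uᵀ := by
    intro V
    rw [Submodule.coe_add, coe_symProduct, coe_symProduct]
    module
  have hSt : Sᵀ = S := by
    have : (g.1)ᵀ = g.1 := g.2
    rw [hS, transpose_add, this]; simp
  constructor
  · apply trForm_self_eq_zero.mp
    -- In the direction W the first-order condition reads 2⟨SU, W⟩ = 0; the choice W = SU gives SU =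
    -- 0.
    obtain ⟨W, hW⟩ : ∃ W, W = S * U := ⟨_, rfl⟩
    have h1 : 0 = trForm g.1 (symProduct U W + symProduct W U : SymMat d).1 +
        (lam * trForm U W + lam * trForm W U) := by
      rw [← (key W).1, hU.1]
      rfl
    have h2 : trForm g.1 (U * Wᵀ + W * Uᵀ) = 2 * trForm (g.1 * U) W := by
      have hgt : (g.1)ᵀ = g.1 := g.2
      rw [trForm_add_right, trForm_comm _ (U * _), trForm_comm _ (W * Uᵀ),
        trForm_mul_right, trForm_mul_right W, transpose_transpose, transpose_transpose,
        trForm_mul_left g.1 U, hgt, trForm_comm W, trForm_mul_left g.1 U, hgt]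
      ring
    have h3 : trForm (S * U) W = trForm (g.1 * U) W + lam * trForm U W := by
      rw [hS, Matrix.add_mul, Matrix.smul_mul, Matrix.one_mul, trForm_add_left, trForm_smul_left]
    rw [hsum, h2, trForm_comm W U] at h1
    rw [← hW] at h3 ⊢
    linarith
  · intro V Y hY
    have h1 := (key V).2
    have h2 := hU.2 V
    have hYe : symProduct U V + symProduct V U = Y := Subtype.ext (by rw [hsum, hY])
    rw [h1, hYe] at h2
    refine h2.trans (le_of_eq ?_)
    have h3 : trForm (1 : Matrix (Fin d) (Fin d) ℝ) (V * Vᵀ) = trForm V V := by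
      rw [trForm_comm, trForm_mul_right]; simp
    have h4 : ((2 : ℝ) • symFactor V : SymMat d).1 = (2 : ℝ) • (V * Vᵀ) := rfl
    rw [h4, hS, trForm_add_left, trForm_smul_left, trForm_smul_right, h3]
    ring

/-- The symmetric case: second-order critical points are optimal. -/
theorem symObjective_landscape {r rs : ℕ} (hrs : 1 ≤ rs) (hr : rs ≤ r) {lam : ℝ} {d : ℕ}
    {φ : SymMat d → ℝ}
    (hφ : LandscapeCondition (fun M : SymMat d => (M : Matrix (Fin d) (Fin d) ℝ).rank)
      (psdCone d) φ r rs)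
    {Mstar : SymMat d} (hMr : (Mstar : Matrix (Fin d) (Fin d) ℝ).rank ≤ rs)
    (hopt : IsSymOptimum φ lam Mstar) {U : Matrix (Fin d) (Fin r) ℝ}
    (hU : IsSecondOrderCritical (symObjective r φ lam) U) :
    U * Uᵀ = (Mstar : Matrix (Fin d) (Fin d) ℝ) := by
  by_contra hne
  obtain ⟨hMpsd, hcs, hdual⟩ := hopt
  obtain ⟨P, hP, hPU, hPM, hPr, -⟩ := exists_projection_rank_le U Mstar.1
  have hPr' : P.rank ≤ r + rs := hPr.trans (add_le_add (rank_le_width U) hMr)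
  -- A linear space of matrices of rank at most r + rs containing both UUᵀ and M_*: on it the
  -- restricted bounds hold in every direction, along the whole segment.
  have hrkT : ∀ Y ∈ symSupported P, (Y : Matrix (Fin d) (Fin d) ℝ).rank ≤ r + rs := by
    intro Y hY
    have hY' : P * (Y : Matrix (Fin d) (Fin d) ℝ) * P = Y := hY
    rw [← hY']
    exact (rank_mul_le_right _ _).trans hPr'
  have hUP : Uᵀ * P = Uᵀ := by
    have := congrArg transpose hPU
    rwa [transpose_mul, hP.1] at this
  have hMt : (Mstar.1)ᵀ = Mstar.1 := Mstar.2
  have hMP : Mstar.1 * P = Mstar.1 := by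
    have := congrArg transpose hPM
    rwa [transpose_mul, hMt, hP.1] at this
  have hMT : Mstar ∈ symSupported P := by
    change P * Mstar.1 * P = Mstar.1
    rw [hPM, hMP]
  have hUT : symFactor U ∈ symSupported P := by
    change P * (U * Uᵀ) * P = U * Uᵀ
    rw [← Matrix.mul_assoc, hPU, Matrix.mul_assoc, hUP]
  have hΔT : symFactor U - Mstar ∈ symSupported P := Submodule.sub_mem _ hUT hMT
  have hΔ0 : symFactor U - Mstar ≠ 0 := fun h0 => hne (congrArg Subtype.val (sub_eq_zero.mp h0))
  have hconv : Convex ℝ (psdCone d) := hφ.1.1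
  obtain ⟨μ, L, L₂, hμ, hμL, hL₂, hgap, hφ2, hbd, hbd2⟩ :=
    hφ.exists_constants hrs hr (symFactor_mem_psdCone U) (hrkT _ hUT) hΔ0 (hrkT _ hΔT)
  set g : SymMat d := gradientWithin φ (psdCone d) (symFactor U) with hg
  set g' : SymMat d := gradientWithin φ (psdCone d) Mstar with hg'
  obtain ⟨S, hS⟩ : ∃ S, S = g.1 + lam • (1 : Matrix (Fin d) (Fin d) ℝ) := ⟨_, rfl⟩
  obtain ⟨T, hT⟩ : ∃ T, T = g'.1 + lam • (1 : Matrix (Fin d) (Fin d) ℝ) := ⟨_, rfl⟩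
  rw [← hT] at hcs hdual
  have hgt : (g.1)ᵀ = g.1 := g.2
  have hgt' : (g'.1)ᵀ = g'.1 := g'.2
  have hSt : Sᵀ = S := by rw [hS, transpose_add, hgt]; simp
  obtain ⟨hSU, hsec⟩ := symObjective_critical hφ2 hU hS
  have : Nonempty (Fin r) := ⟨⟨0, by omega⟩⟩
  obtain ⟨w, hw, hmin⟩ := exists_min_direction U
  set a := U *ᵥ w with ha
  -- The direction x wᵀ moves UUᵀ to first order by axᵀ + xaᵀ, of rank at most 2 and, for x ⊥ a, of
  -- squared norm 2|a|²|x|². The remaining direction a lies in the kernel of S.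
  have hlow : ∀ x, -(L₂ * (a ⬝ᵥ a)) * (x ⬝ᵥ x) ≤ x ⬝ᵥ (S *ᵥ x) := by
    refine quadratic_lower_bound_of_orthogonal hSt (a := a) ?_
      (mul_nonneg hL₂ (dotProduct_self_nonneg' a)) ?_
    · rw [ha, Matrix.mulVec_mulVec, hSU, Matrix.zero_mulVec]
    intro x hxa
    have e1 : U * (vecMulVec x w)ᵀ = vecMulVec a x := by
      rw [transpose_vecMulVec, mul_vecMulVec]
    have e2 : vecMulVec x w * Uᵀ = vecMulVec x a := by
      rw [vecMulVec_mul, vecMul_transpose]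
    have e3 : vecMulVec x w * (vecMulVec x w)ᵀ = vecMulVec x x := by
      rw [transpose_vecMulVec, vecMulVec_mul_vecMulVec, hw]
      simp
    have hYsym : vecMulVec a x + vecMulVec x a ∈ SymMat d := by
      change (vecMulVec a x + vecMulVec x a)ᵀ = _
      rw [transpose_add, transpose_vecMulVec, transpose_vecMulVec, add_comm]
    have h1 := hsec (vecMulVec x w) ⟨_, hYsym⟩ (by rw [e1, e2])
    have h2 := hbd2 (symFactor U) (symFactor_mem_psdCone U) (hrkT _ hUT) ⟨_, hYsym⟩
      ((matrix_rank_add_le _ _).trans (add_le_add (rank_vecMulVec_le _ _) (rank_vecMulVec_le _ _)))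
    rw [symMat_norm_sq_eq_trForm, trForm_add_left, trForm_add_right, trForm_add_right,
      trForm_vecMulVec_vecMulVec, trForm_vecMulVec_vecMulVec, trForm_vecMulVec_vecMulVec,
      trForm_vecMulVec_vecMulVec, hxa] at h2
    rw [e3, trForm_vecMulVec] at h1
    linarith
  have hsub : S - T = g.1 - g'.1 := by rw [hS, hT]; abel
  have hDt : (P * (S - T) * P)ᵀ = P * (S - T) * P := by
    rw [hsub, transpose_mul, transpose_mul, transpose_sub, hgt, hgt', hP.1, Matrix.mul_assoc]
  have hDT : (⟨P * (S - T) * P, hDt⟩ : SymMat d) ∈ symSupported P := by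
    change P * (P * (S - T) * P) * P = P * (S - T) * P
    simp only [← Matrix.mul_assoc, hP.2]
    rw [Matrix.mul_assoc, hP.2]
  have hseg : ∀ z ∈ segment ℝ Mstar (symFactor U), z ∈ psdCone d ∧ z ∈ symSupported P :=
    fun z hz => ⟨hconv.segment_subset hMpsd (symFactor_mem_psdCone U) hz,
      (symSupported P).convex.segment_subset hMT hUT hz⟩
  have hcoc := restricted_cocoercivity hconv (psdCone_interior_nonempty d) hφ2 (symSupported P)
    hμL hMpsd (symFactor_mem_psdCone U) hΔT
    (fun z hz X hX => hbd z (hseg z hz).1 (hrkT z (hseg z hz).2) X (hrkT X hX)) hDT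
    (fun Y hY => by
      have hY' : P * (Y : Matrix (Fin d) (Fin d) ℝ) * P = Y := hY
      rw [← inner_gradientWithin, ← inner_gradientWithin, ← inner_sub_left,
        symMat_inner_eq_trForm, symMat_inner_eq_trForm]
      change trForm (g.1 - g'.1) Y.1 = trForm (P * (S - T) * P) Y.1
      rw [trForm_mul_right, trForm_mul_left, hP.1, ← Matrix.mul_assoc, hY', hsub])
  rw [symMat_inner_eq_trForm, symMat_inner_eq_trForm, symMat_inner_eq_trForm] at hcoc
  refine hne (eq_of_dual_matrices hrs hr hμ hμL hL₂ (dotProduct_self_nonneg' a) hgap U hmin Mstar.1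
    S T P hSt hSU hlow hdual hMpsd hMr ?_ hP hPU hPM ?_ hcoc)
  · rw [trForm, (posSemidef_iff_dotProduct.mp hdual).1, hcs, trace_zero]
  · intro N _ hDN
    -- ‖D + N‖² ≥ 0 together with ⟨D, N⟩ ≤ -‖N‖² gives ‖N‖² ≤ ‖D‖².
    have := trForm_self_nonneg (P * (S - T) * P + N)
    rw [trForm_add_left, trForm_add_right, trForm_add_right, trForm_comm N] at this
    change trForm N N ≤ trForm (P * (S - T) * P) (P * (S - T) * P)
    linarith

/-! ### Singular values and factorizations attaining the nuclear norm. -/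

section NuclearNorm

/-- A singular value decomposition adapted to the definition of the nuclear norm. -/
lemma exists_singular_value_decomposition {m n : ℕ} (M : Matrix (Fin m) (Fin n) ℝ) :
    ∃ (A : Matrix (Fin m) (Fin n) ℝ) (Q : Matrix (Fin n) (Fin n) ℝ) (σ : Fin n → ℝ),
      Qᵀ * Q = 1 ∧ Q * Qᵀ = 1 ∧ (∀ i, 0 ≤ σ i) ∧ M = A * diagonal σ * Qᵀ ∧
      Aᵀ * A = diagonal (fun i => σ i * (σ i)⁻¹) ∧ A * diagonal (fun i => σ i * (σ i)⁻¹) = A ∧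
      nuclearNorm M = ∑ i, σ i := by
  set T := Matrix.toEuclideanLin M with hT
  have hn : Module.finrank ℝ (EuclideanSpace ℝ (Fin n)) = n := by simp
  set hsym := T.isSymmetric_adjoint_comp_self
  set b := hsym.eigenvectorBasis hn with hb
  set e := hsym.eigenvalues hn with he
  set σ : Fin n → ℝ := fun i => T.singularValues i with hσ
  have hσe : ∀ i, σ i * σ i = e i := fun i => by
    rw [← sq]; exact T.sq_singularValues_fin hn i
  set Q : Matrix (Fin n) (Fin n) ℝ := Matrix.of fun i j => b j i with hQ
  have hQ1 : Qᵀ * Q = 1 := by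
    ext j k
    have := orthonormal_iff_ite.mp b.orthonormal k j
    simp only [PiLp.inner_apply, RCLike.inner_apply, conj_trivial] at this
    rw [Matrix.mul_apply, Matrix.one_apply]
    simp only [eq_comm (a := j)]
    rw [← this]
    rfl
  have hQ2 : Q * Qᵀ = 1 := mul_eq_one_comm.mp hQ1
  have hB : (M * Q)ᵀ * (M * Q) = diagonal e := by
    ext j k
    have h1 : inner ℝ (T (b k)) (T (b j)) = e j * inner ℝ (b k) (b j) := by
      rw [← LinearMap.adjoint_inner_right, ← LinearMap.comp_apply, hb,
        hsym.apply_eigenvectorBasis hn j, inner_smul_right]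
      rfl
    rw [orthonormal_iff_ite.mp b.orthonormal k j] at h1
    have h2 : inner ℝ (T (b k)) (T (b j)) = ((M * Q)ᵀ * (M * Q)) j k := by
      rw [PiLp.inner_apply, Matrix.mul_apply]
      rfl
    rw [← h2, h1, diagonal_apply]
    by_cases h : j = k
    · simp [h]
    · simp [h, Ne.symm h]
  -- With 0⁻¹ = 0, the product σσ⁻¹ is the indicator of σ ≠ 0; the columns of MQ have squared
  -- lengths σ², so those dropped are zero.
  have hBσ : M * Q * diagonal (fun i => σ i * (σ i)⁻¹) = M * Q := by
    rw [← sub_eq_zero, ← neg_eq_zero, neg_sub]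
    apply trForm_self_eq_zero.mp
    have : M * Q - M * Q * diagonal (fun i => σ i * (σ i)⁻¹) =
        M * Q * diagonal (fun i => 1 - σ i * (σ i)⁻¹) := by
      conv_lhs => rw [← Matrix.mul_one (M * Q), ← diagonal_one, Matrix.mul_assoc (M * Q),
        ← Matrix.mul_sub, diagonal_mul_diagonal, diagonal_sub]
      simp
    rw [this, trForm, transpose_mul, Matrix.mul_assoc, ← Matrix.mul_assoc (M * Q)ᵀ, hB,
      diagonal_transpose, diagonal_mul_diagonal, diagonal_mul_diagonal, trace_diagonal]
    refine Finset.sum_eq_zero fun i _ => ?_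
    rw [← hσe]
    by_cases h : σ i = 0
    · simp [h]
    · simp [h]
  refine ⟨M * Q * diagonal (fun i => (σ i)⁻¹), Q, σ, hQ1, hQ2, fun i => T.singularValues_nonneg i,
    ?_, ?_, ?_, ?_⟩
  · rw [Matrix.mul_assoc (M * Q), diagonal_mul_diagonal]
    simp only [mul_comm (_)⁻¹]
    rw [hBσ, Matrix.mul_assoc, hQ2, Matrix.mul_one]
  · rw [transpose_mul, Matrix.mul_assoc, ← Matrix.mul_assoc (M * Q)ᵀ, hB,
      diagonal_transpose, diagonal_mul_diagonal, diagonal_mul_diagonal]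
    congr 1
    ext i
    rw [← hσe]
    by_cases h : σ i = 0
    · simp [h]
    · field_simp
  · rw [Matrix.mul_assoc (M * Q), diagonal_mul_diagonal]
    congr 2
    ext i
    by_cases h : σ i = 0
    · simp [h]
    · field_simp
  · rw [nuclearNorm, Finset.sum_range]

/-- The variational upper bound for the nuclear norm. -/
theorem nuclearNorm_mul_transpose_le {m n : ℕ} {p : Type*} [Fintype p] (X : Matrix (Fin m) p ℝ)
    (Y : Matrix (Fin n) p ℝ) :
    nuclearNorm (X * Yᵀ) ≤ (trForm X X + trForm Y Y) / 2 := by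
  obtain ⟨A, Q, σ, hQ1, hQ2, hσ, hM, hA, hAσ, hnuc⟩ := exists_singular_value_decomposition (X * Yᵀ)
  -- The nuclear norm as the pairing of XYᵀ with the partial isometry AQᵀ. Neither Aᵀ nor Qᵀ
  -- increases Frobenius norms, so 2⟨u, v⟩ ≤ ‖u‖² + ‖v‖² concludes.
  have h1 : ∑ i, σ i = trForm (Aᵀ * X) (Qᵀ * Y) := by
    have h2 : Aᵀ * (X * Yᵀ) * Q = diagonal σ := by
      rw [hM]
      calc _ = (Aᵀ * A) * diagonal σ * (Qᵀ * Q) := by simp only [Matrix.mul_assoc]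
        _ = _ := by
          rw [hA, hQ1, Matrix.mul_one, diagonal_mul_diagonal]
          congr 1
          ext i
          by_cases h : σ i = 0
          · simp [h]
          · field_simp
    rw [← trace_diagonal, ← h2, ← Matrix.trace_transpose]
    simp only [trForm, transpose_mul, transpose_transpose]
    rw [Matrix.trace_mul_comm, Matrix.mul_assoc, Matrix.mul_assoc, Matrix.trace_mul_comm]
    simp only [Matrix.mul_assoc]
  have hR : IsOrthProj (A * Aᵀ) := by
    refine ⟨by simp, ?_⟩
    calc A * Aᵀ * (A * Aᵀ) = A * (Aᵀ * A) * Aᵀ := by simp only [Matrix.mul_assoc]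
      _ = _ := by rw [hA, hAσ]
  have h3 : trForm (Aᵀ * X) (Aᵀ * X) ≤ trForm X X := by
    refine le_trans (le_of_eq ?_) (hR.trForm_mul_left_le X)
    rw [trForm_mul_left, trForm_mul_left (A * Aᵀ), hR.1, transpose_transpose, ← Matrix.mul_assoc,
      ← Matrix.mul_assoc (A * Aᵀ), hR.2]
  have h4 : trForm (Qᵀ * Y) (Qᵀ * Y) = trForm Y Y := by
    rw [trForm_mul_left, transpose_transpose, ← Matrix.mul_assoc, hQ2, Matrix.one_mul]
  have h5 := trForm_self_nonneg (Aᵀ * X - Qᵀ * Y)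
  rw [trForm_sub_left, trForm_sub_right, trForm_sub_right, trForm_comm (Qᵀ * Y) (Aᵀ * X), h4] at h5
  rw [hnuc, h1]
  linarith

/-- A balanced factorization attaining the nuclear norm. -/
theorem exists_balanced_factorization {m n : ℕ} (M : Matrix (Fin m) (Fin n) ℝ) :
    ∃ (X : Matrix (Fin m) (Fin n) ℝ) (Y : Matrix (Fin n) (Fin n) ℝ), M = X * Yᵀ ∧
      Xᵀ * X = Yᵀ * Y ∧ trForm X X + trForm Y Y = 2 * nuclearNorm M ∧
      X.rank ≤ M.rank ∧ Y.rank ≤ M.rank := by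
  obtain ⟨A, Q, σ, hQ1, hQ2, hσ, hM, hA, hAσ, hnuc⟩ := exists_singular_value_decomposition M
  have hsq : diagonal (fun i => √(σ i)) * diagonal (fun i => √(σ i)) = diagonal σ := by
    rw [diagonal_mul_diagonal]
    congr 1
    ext i
    exact Real.mul_self_sqrt (hσ i)
  have hX : (A * diagonal (fun i => √(σ i)))ᵀ * (A * diagonal (fun i => √(σ i))) = diagonal σ := by
    rw [transpose_mul, Matrix.mul_assoc, ← Matrix.mul_assoc Aᵀ, hA, diagonal_transpose,
      diagonal_mul_diagonal, diagonal_mul_diagonal]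
    congr 1
    ext i
    have := Real.mul_self_sqrt (hσ i)
    by_cases h : σ i = 0
    · simp [h]
    · rw [mul_inv_cancel₀ h, one_mul, this]
  have hY : (Q * diagonal (fun i => √(σ i)))ᵀ * (Q * diagonal (fun i => √(σ i))) = diagonal σ := by
    rw [transpose_mul, Matrix.mul_assoc, ← Matrix.mul_assoc Qᵀ, hQ1, Matrix.one_mul,
      diagonal_transpose, hsq]
  have hr : (diagonal (fun i => √(σ i))).rank ≤ M.rank := by
    have h1 : (diagonal (fun i => √(σ i))).rank = (diagonal σ).rank := by
      rw [rank_diagonal, rank_diagonal]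
      refine Fintype.card_congr (Equiv.subtypeEquivRight fun i => ?_)
      rw [Ne, Ne, Real.sqrt_eq_zero (hσ i)]
    have h2 : diagonal σ = Aᵀ * M * Q := by
      rw [hM]
      calc diagonal σ = (Aᵀ * A) * diagonal σ * (Qᵀ * Q) := by
            rw [hA, hQ1, Matrix.mul_one, diagonal_mul_diagonal]
            congr 1
            ext i
            by_cases h : σ i = 0
            · simp [h]
            · field_simp
        _ = _ := by simp only [Matrix.mul_assoc]
    rw [h1, h2]
    exact (rank_mul_le_left _ _).trans (rank_mul_le_right _ _)
  refine ⟨A * diagonal (fun i => √(σ i)), Q * diagonal (fun i => √(σ i)), ?_, hX.trans hY.symm, ?_,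
    (rank_mul_le_right _ _).trans hr, (rank_mul_le_right _ _).trans hr⟩
  · rw [transpose_mul, diagonal_transpose, Matrix.mul_assoc, ← Matrix.mul_assoc _ _ Qᵀ, hsq,
      ← Matrix.mul_assoc, hM]
  · rw [trForm, trForm, hX, hY, trace_diagonal, hnuc]; ring

end NuclearNorm

/-! ### Block matrices and balanced lifts. -/

section Blocks

variable {m n p q : Type*} [Fintype m] [Fintype n] [Fintype p] [Fintype q]

lemma fromBlocks_sub_fromBlocks {m n : Type*} (A A' : Matrix m m ℝ) (B B' : Matrix m n ℝ) (C C' : Matrix n m ℝ)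
    (D D' : Matrix n n ℝ) :
    fromBlocks A B C D - fromBlocks A' B' C' D' =
      fromBlocks (A - A') (B - B') (C - C') (D - D') := by
  ext i j
  rcases i with i | i <;> rcases j with j | j <;> rfl

lemma trForm_fromBlocks (A A' : Matrix m m ℝ) (B B' : Matrix m n ℝ) (C C' : Matrix n m ℝ)
    (D D' : Matrix n n ℝ) :
    trForm (fromBlocks A B C D) (fromBlocks A' B' C' D') =
      trForm A A' + trForm B B' + trForm C C' + trForm D D' := by
  simp only [trForm_eq_sum, Fintype.sum_sum_type, fromBlocks_apply₁₁, fromBlocks_apply₁₂,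
    fromBlocks_apply₂₁, fromBlocks_apply₂₂, Finset.sum_add_distrib]
  ring

lemma trForm_fromCols (A A' : Matrix m p ℝ) (B B' : Matrix m q ℝ) :
    trForm (fromCols A B) (fromCols A' B') = trForm A A' + trForm B B' := by
  simp only [trForm_eq_sum, Fintype.sum_sum_type, fromCols_apply_inl, fromCols_apply_inr,
    Finset.sum_add_distrib]

lemma trForm_gram (A : Matrix m p ℝ) (B : Matrix n p ℝ) (C : Matrix m q ℝ) (D : Matrix n q ℝ) :
    trForm (A * Bᵀ) (C * Dᵀ) = trForm (Aᵀ * C) (Bᵀ * D) := by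
  rw [trForm, trForm, ← Matrix.mul_assoc, Matrix.trace_mul_comm,
    ← Matrix.trace_transpose ((Aᵀ * C)ᵀ * _)]
  simp only [transpose_mul, transpose_transpose, Matrix.mul_assoc]

/-- For balanced factorizations the off-diagonal blocks control the whole lifted difference. -/
lemma balanced_diagonal_blocks_le {U : Matrix m p ℝ} {V : Matrix n p ℝ} {X : Matrix m q ℝ}
    {Y : Matrix n q ℝ} (hUV : Uᵀ * U = Vᵀ * V) (hXY : Xᵀ * X = Yᵀ * Y) :
    trForm (U * Uᵀ - X * Xᵀ) (U * Uᵀ - X * Xᵀ) + trForm (V * Vᵀ - Y * Yᵀ) (V * Vᵀ - Y * Yᵀ) ≤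
      2 * trForm (U * Vᵀ - X * Yᵀ) (U * Vᵀ - X * Yᵀ) := by
  -- Under the two balance conditions, the right side minus the left is exactly twice this square.
  have h := trForm_self_nonneg (Uᵀ * X - Vᵀ * Y)
  simp only [trForm_sub_left, trForm_sub_right] at h ⊢
  rw [trForm_comm (X * Xᵀ) (U * Uᵀ), trForm_comm (Y * Yᵀ) (V * Vᵀ), trForm_comm (X * Yᵀ) (U * Vᵀ)]
  rw [trForm_comm (Vᵀ * Y)] at h
  simp only [trForm_gram, ← hUV, ← hXY]
  linarith

end Blocks

/-! ### Critical points of the asymmetric objective. -/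

section AsymmetricDerivatives

variable {d₁ d₂ r : ℕ}

/-- The polarization of the map `(U, V) ↦ U Vᵀ`. -/
noncomputable def asymProduct
    (a b : Matrix (Fin d₁) (Fin r) ℝ × Matrix (Fin d₂) (Fin r) ℝ) : Matrix (Fin d₁) (Fin d₂) ℝ :=
  (1 / 2 : ℝ) • (a.1 * b.2ᵀ + b.1 * a.2ᵀ)

lemma isBilinearMap_asymProduct :
    IsBilinearMap ℝ (asymProduct : Matrix (Fin d₁) (Fin r) ℝ × Matrix (Fin d₂) (Fin r) ℝ →
      Matrix (Fin d₁) (Fin r) ℝ × Matrix (Fin d₂) (Fin r) ℝ → _) where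
  add_left a a' b := by
    simp only [asymProduct, Prod.fst_add, Prod.snd_add, transpose_add, Matrix.add_mul,
      Matrix.mul_add]
    module
  smul_left c a b := by
    simp only [asymProduct, Prod.smul_fst, Prod.smul_snd, transpose_smul, Matrix.smul_mul,
      Matrix.mul_smul]
    module
  add_right a b b' := by
    simp only [asymProduct, Prod.fst_add, Prod.snd_add, transpose_add, Matrix.add_mul,
      Matrix.mul_add]
    module
  smul_right c a b := by
    simp only [asymProduct, Prod.smul_fst, Prod.smul_snd, transpose_smul, Matrix.smul_mul,
      Matrix.mul_smul]
    module

lemma isBilinearMap_prod_trForm (c : ℝ) :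
    IsBilinearMap ℝ (fun a b : Matrix (Fin d₁) (Fin r) ℝ × Matrix (Fin d₂) (Fin r) ℝ =>
      c * (trForm a.1 b.1 + trForm a.2 b.2)) where
  add_left A B C := by simp only [Prod.fst_add, Prod.snd_add, trForm_add_left]; ring
  smul_left a A B := by
    simp only [Prod.smul_fst, Prod.smul_snd, trForm_smul_left, smul_eq_mul]; ring
  add_right A B C := by simp only [Prod.fst_add, Prod.snd_add, trForm_add_right]; ring
  smul_right a A B := by
    simp only [Prod.smul_fst, Prod.smul_snd, trForm_smul_right, smul_eq_mul]; ring

lemma inner_gradient_univ {E : Type*} [NormedAddCommGroup E] [InnerProductSpace ℝ E]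
    [CompleteSpace E] (φ : E → ℝ) (x v : E) :
    fderivWithin ℝ φ univ x v = inner ℝ (gradient φ x) v := by
  rw [← inner_gradientWithin, gradientWithin_univ]

/-- Second-order criticality for the asymmetric factored objective, in matrix terms. -/
theorem asymObjective_critical {φ : Matrix (Fin d₁) (Fin d₂) ℝ → ℝ}
    (hφ : TwiceDifferentiableOn φ univ) {lam : ℝ} {U : Matrix (Fin d₁) (Fin r) ℝ}
    {V : Matrix (Fin d₂) (Fin r) ℝ} (hUV : IsSecondOrderCritical (asymObjective r φ lam) (U, V)) :
    gradient φ (U * Vᵀ) * V + lam • U = 0 ∧ (gradient φ (U * Vᵀ))ᵀ * U + lam • V = 0 ∧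
    ∀ (X : Matrix (Fin d₁) (Fin r) ℝ) (Y : Matrix (Fin d₂) (Fin r) ℝ),
      0 ≤ hessForm φ univ (U * Vᵀ) (U * Yᵀ + X * Vᵀ) + 2 * trForm (gradient φ (U * Vᵀ)) (X * Yᵀ) +
        lam * (trForm X X + trForm Y Y) := by
  have hdiag : ∀ a : Matrix (Fin d₁) (Fin r) ℝ × Matrix (Fin d₂) (Fin r) ℝ,
      asymProduct a a = a.1 * a.2ᵀ := by
    intro a
    rw [asymProduct, ← two_smul ℝ, smul_smul]
    simp
  have hsum : ∀ (X : Matrix (Fin d₁) (Fin r) ℝ) (Y : Matrix (Fin d₂) (Fin r) ℝ),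
      asymProduct (U, V) (X, Y) + asymProduct (X, Y) (U, V) = U * Yᵀ + X * Vᵀ := by
    intro X Y
    simp only [asymProduct]
    module
  have key := fun X Y => derivatives_bilinear_composition hφ isBilinearMap_asymProduct
    (isBilinearMap_prod_trForm (lam / 2)) (fun a => mem_univ _)
    (f := asymObjective r φ lam) (fun a => by
      rw [hdiag, asymObjective, norm_sq_eq_trForm, norm_sq_eq_trForm]; ring) (U, V) (X, Y)
  simp only [hdiag, hsum, inner_gradient_univ, inner_eq_trForm] at key
  set g := gradient φ (U * Vᵀ) with hg
  have hfirst : ∀ (X : Matrix (Fin d₁) (Fin r) ℝ) (Y : Matrix (Fin d₂) (Fin r) ℝ),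
      trForm (g * V + lam • U) X + trForm (gᵀ * U + lam • V) Y = 0 := by
    intro X Y
    have h1 : 0 = trForm g (U * Yᵀ + X * Vᵀ) +
        (lam / 2 * (trForm U X + trForm V Y) + lam / 2 * (trForm X U + trForm Y V)) := by
      rw [← (key X Y).1, hUV.1]
      rfl
    rw [trForm_add_right, trForm_comm g, trForm_comm g, trForm_mul_left, trForm_mul_right X,
      transpose_transpose, ← trForm_transpose Yᵀ, transpose_transpose, transpose_mul,
      transpose_transpose] at h1
    rw [trForm_add_left, trForm_add_left, trForm_smul_left, trForm_smul_left, trForm_comm (g * V),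
      trForm_comm (gᵀ * U)]
    rw [trForm_comm X U, trForm_comm Y V] at h1
    linarith
  refine ⟨?_, ?_, fun X Y => ?_⟩
  · have := hfirst (g * V + lam • U) 0
    rw [trForm_zero_right, add_zero] at this
    exact trForm_self_eq_zero.mp this
  · have := hfirst 0 (gᵀ * U + lam • V)
    rw [trForm_zero_right, zero_add] at this
    exact trForm_self_eq_zero.mp this
  · have h1 := (key X Y).2
    have h2 := hUV.2 (X, Y)
    rw [h1, trForm_smul_right] at h2
    linarith

end AsymmetricDerivatives

/-! ### The dual certificate of the asymmetric optimum. -/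

section AsymmetricOptimum

variable {d₁ d₂ : ℕ}

lemma dotProduct_sum_elim {m n : Type*} [Fintype m] [Fintype n] (a b : m → ℝ) (c d : n → ℝ) :
    Sum.elim a c ⬝ᵥ Sum.elim b d = a ⬝ᵥ b + c ⬝ᵥ d := by
  simp [dotProduct, Fintype.sum_sum_type]

lemma sum_elim_quadratic {m n : Type*} [Fintype m] [Fintype n] [DecidableEq m] [DecidableEq n]
    (lam : ℝ) (g : Matrix m n ℝ) (x : m → ℝ) (y : n → ℝ) :
    Sum.elim x y ⬝ᵥ (fromBlocks (lam • 1) g gᵀ (lam • 1) *ᵥ Sum.elim x y) =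
      lam * (x ⬝ᵥ x + y ⬝ᵥ y) + 2 * (x ⬝ᵥ (g *ᵥ y)) := by
  rw [fromBlocks_mulVec]
  simp only [Sum.elim_comp_inl, Sum.elim_comp_inr]
  rw [dotProduct_sum_elim, dotProduct_add, dotProduct_add, smul_mulVec, smul_mulVec,
    one_mulVec, one_mulVec, dotProduct_smul, dotProduct_smul, Matrix.mulVec_transpose,
    dotProduct_comm y (x ᵥ* g), ← Matrix.dotProduct_mulVec]
  simp only [smul_eq_mul]
  ring

/-- Dual certificate of optimality: dual feasibility and complementary slackness. -/
theorem IsAsymOptimum.dual_certificate {φ : Matrix (Fin d₁) (Fin d₂) ℝ → ℝ} {lam : ℝ}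
    (hlam : 0 ≤ lam) {M : Matrix (Fin d₁) (Fin d₂) ℝ} (h : IsAsymOptimum φ lam M)
    {q : ℕ} {X : Matrix (Fin d₁) (Fin q) ℝ} {Y : Matrix (Fin d₂) (Fin q) ℝ} (hM : M = X * Yᵀ)
    (hnuc : trForm X X + trForm Y Y = 2 * nuclearNorm M) :
    (fromBlocks (lam • 1) (gradient φ M) (gradient φ M)ᵀ (lam • 1)).PosSemidef ∧
      trForm (fromBlocks (lam • 1) (gradient φ M) (gradient φ M)ᵀ (lam • 1))
        (fromRows X Y * (fromRows X Y)ᵀ) ≤ 0 := by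
  obtain ⟨G, hG, hgrad⟩ := h
  rw [hgrad]
  constructor
  · refine posSemidef_iff_dotProduct.mpr ⟨by simp [fromBlocks_transpose], fun z => ?_⟩
    obtain ⟨x, y, rfl⟩ : ∃ x y, z = Sum.elim x y := ⟨z ∘ Sum.inl, z ∘ Sum.inr, by simp⟩
    rw [sum_elim_quadratic]
    -- Appending the columns x and y to X and Y factors M + xyᵀ, so the nuclear norm grows by at
    -- most (|x|² + |y|²)/2. This bounds xᵀGy, i.e. the operator norm of G by 1.
    have h1 := hG (M + vecMulVec x y)
    have h2 : M + vecMulVec x y =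
        fromCols X (replicateCol Unit x) * (fromCols Y (replicateCol Unit y))ᵀ := by
      rw [transpose_fromCols, fromCols_mul_fromRows, hM, vecMulVec_eq Unit, transpose_replicateCol]
    have h3 := nuclearNorm_mul_transpose_le (fromCols X (replicateCol Unit x))
      (fromCols Y (replicateCol Unit y))
    have h4 : ∀ {k : ℕ} (v : Fin k → ℝ),
        trForm (replicateCol Unit v) (replicateCol Unit v) = v ⬝ᵥ v := by
      intro k v
      simp [trForm_eq_sum, dotProduct]
    rw [← h2, trForm_fromCols, trForm_fromCols, h4, h4] at h3
    rw [inner_eq_trForm, add_sub_cancel_left, trForm_vecMulVec] at h1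
    have h5 : x ⬝ᵥ (G *ᵥ y) ≤ (x ⬝ᵥ x + y ⬝ᵥ y) / 2 := by linarith
    rw [smul_mulVec, dotProduct_smul, smul_eq_mul]
    have := mul_le_mul_of_nonneg_left h5 hlam
    linarith
  -- The subgradient inequality at 0 gives ‖M‖_* ≤ ⟨G, M⟩, which is complementary slackness.
  · have h1 := hG 0
    have h0 : nuclearNorm (0 : Matrix (Fin d₁) (Fin d₂) ℝ) ≤ 0 := by
      have := nuclearNorm_mul_transpose_le (0 : Matrix (Fin d₁) (Fin 0) ℝ)
        (0 : Matrix (Fin d₂) (Fin 0) ℝ)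
      simpa using this
    rw [inner_eq_trForm, zero_sub, ← neg_one_smul ℝ M, trForm_smul_right] at h1
    have htr : ∀ {k l : ℕ} (A : Matrix (Fin k) (Fin l) ℝ),
        trForm (lam • (1 : Matrix (Fin k) (Fin k) ℝ)) (A * Aᵀ) = lam * trForm A A := by
      intro k l A
      rw [trForm_smul_left, trForm_comm, trForm_mul_right]
      simp
    have hYX : Y * Xᵀ = Mᵀ := by rw [hM]; simp
    rw [transpose_fromRows, fromRows_mul_fromCols, trForm_fromBlocks, htr, htr, hYX,
      trForm_transpose, ← hM, trForm_smul_left]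
    have h2 : lam * (nuclearNorm M - trForm G M) ≤ 0 :=
      mul_nonpos_of_nonneg_of_nonpos hlam (by linarith)
    nlinarith

end AsymmetricOptimum

/-! ### The lifted argument for balanced factors. -/

section AsymmetricLandscape

variable {d₁ d₂ r rs : ℕ}

/-- The matrices whose columns and rows are supported on the ranges of two projections. -/
def asymSupported (P : Matrix (Fin d₁) (Fin d₁) ℝ) (Q : Matrix (Fin d₂) (Fin d₂) ℝ) :
    Submodule ℝ (Matrix (Fin d₁) (Fin d₂) ℝ) where
  carrier := {Y | P * Y * Q = Y}
  add_mem' {a b} ha hb := by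
    simp only [mem_ofPred_eq, Matrix.mul_add, Matrix.add_mul] at *
    rw [ha, hb]
  zero_mem' := by simp
  smul_mem' c x hx := by
    simp only [mem_ofPred_eq, Matrix.mul_smul, Matrix.smul_mul] at *
    rw [hx]

lemma mul_transpose_mem_asymSupported {q : Type*} [Fintype q] {P : Matrix (Fin d₁) (Fin d₁) ℝ}
    {Q : Matrix (Fin d₂) (Fin d₂) ℝ} (hQ : IsOrthProj Q) {X : Matrix (Fin d₁) q ℝ}
    {Y : Matrix (Fin d₂) q ℝ} (hX : P * X = X) (hY : Q * Y = Y) :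
    X * Yᵀ ∈ asymSupported P Q := by
  change P * (X * Yᵀ) * Q = X * Yᵀ
  rw [← Matrix.mul_assoc, hX, Matrix.mul_assoc]
  have := congrArg transpose hY
  rw [transpose_mul, hQ.1] at this
  rw [this]

/-- The cocoercivity inequality on the matrices supported on two subspaces. -/
lemma asym_cocoercivity {φ : Matrix (Fin d₁) (Fin d₂) ℝ → ℝ} (hφ : TwiceDifferentiableOn φ univ)
    {μ L : ℝ} (hμL : μ ≤ L) {k : ℕ}
    (hbd : ∀ M ∈ univ, M.rank ≤ k → ∀ Y : Matrix (Fin d₁) (Fin d₂) ℝ, Y.rank ≤ k →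
      μ * ‖Y‖ ^ 2 ≤ hessForm φ univ M Y ∧ hessForm φ univ M Y ≤ L * ‖Y‖ ^ 2)
    {P : Matrix (Fin d₁) (Fin d₁) ℝ} {Q : Matrix (Fin d₂) (Fin d₂) ℝ} (hP : IsOrthProj P)
    (hQ : IsOrthProj Q) (hPk : P.rank ≤ k) {M N : Matrix (Fin d₁) (Fin d₂) ℝ}
    (hM : M ∈ asymSupported P Q) (hN : N ∈ asymSupported P Q) {D : Matrix (Fin d₁) (Fin d₂) ℝ}
    (hD : D = P * (gradient φ M - gradient φ N) * Q) :
    trForm D D + μ * L * trForm (M - N) (M - N) ≤ (μ + L) * trForm D (M - N) := by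
  have hrk : ∀ Y ∈ asymSupported P Q, Y.rank ≤ k := by
    intro Y hY
    have hY' : P * Y * Q = Y := hY
    rw [← hY', Matrix.mul_assoc]
    exact (rank_mul_le_left _ _).trans hPk
  have hDT : D ∈ asymSupported P Q := by
    change P * D * Q = D
    rw [hD]
    simp only [← Matrix.mul_assoc, hP.2]
    rw [Matrix.mul_assoc, hQ.2]
  refine restricted_cocoercivity convex_univ (by simp) hφ (asymSupported P Q) hμL (mem_univ N)
    (mem_univ M) (Submodule.sub_mem _ hM hN) (fun z hz X hX => hbd z (mem_univ z)
      (hrk z ((asymSupported P Q).convex.segment_subset hN hM hz)) X (hrk X hX)) hDT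
    (fun Y hY => ?_)
  have hY' : P * Y * Q = Y := hY
  rw [inner_gradient_univ, inner_gradient_univ, ← inner_sub_left, inner_eq_trForm, inner_eq_trForm,
    hD, trForm_mul_right, trForm_mul_left, hP.1, hQ.1, ← Matrix.mul_assoc, hY']

/-- The asymmetric case for balanced critical points. -/
theorem asym_landscape_of_balanced (hrs : 1 ≤ rs) (hr : rs ≤ r) {lam : ℝ} {μ L L₂ : ℝ}
    (hμ : 0 < μ) (hμL : μ ≤ L) (hL₂ : 0 ≤ L₂) (hgap : L₂ < μ * (2 * √((r : ℝ) / rs) + L₂ / L))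
    {U : Matrix (Fin d₁) (Fin r) ℝ} {V : Matrix (Fin d₂) (Fin r) ℝ} (hbal : Uᵀ * U = Vᵀ * V)
    {g g' : Matrix (Fin d₁) (Fin d₂) ℝ} (hgV : g * V + lam • U = 0) (hgU : gᵀ * U + lam • V = 0)
    {H : Matrix (Fin d₁) (Fin d₂) ℝ → ℝ} (hH : ∀ Y : Matrix (Fin d₁) (Fin d₂) ℝ, Y.rank ≤ 2 →
      H Y ≤ L₂ * trForm Y Y)
    (hsec : ∀ (X : Matrix (Fin d₁) (Fin r) ℝ) (Y : Matrix (Fin d₂) (Fin r) ℝ),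
      0 ≤ H (U * Yᵀ + X * Vᵀ) + 2 * trForm g (X * Yᵀ) + lam * (trForm X X + trForm Y Y))
    {q : ℕ} {X : Matrix (Fin d₁) (Fin q) ℝ} {Y : Matrix (Fin d₂) (Fin q) ℝ}
    (hXY : Xᵀ * X = Yᵀ * Y) (hYr : Y.rank ≤ rs)
    (hT : (fromBlocks (lam • 1) g' g'ᵀ (lam • 1)).PosSemidef)
    (hTM : trForm (fromBlocks (lam • 1) g' g'ᵀ (lam • 1)) (fromRows X Y * (fromRows X Y)ᵀ) ≤ 0)
    {P : Matrix (Fin d₁) (Fin d₁) ℝ} {Q : Matrix (Fin d₂) (Fin d₂) ℝ} (hP : IsOrthProj P)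
    (hQ : IsOrthProj Q) (hPU : P * U = U) (hPX : P * X = X) (hQV : Q * V = V) (hQY : Q * Y = Y)
    {D : Matrix (Fin d₁) (Fin d₂) ℝ} (hD : D = P * (g - g') * Q)
    (hcoc : trForm D D + μ * L * trForm (U * Vᵀ - X * Yᵀ) (U * Vᵀ - X * Yᵀ) ≤
      (μ + L) * trForm D (U * Vᵀ - X * Yᵀ)) :
    U * Vᵀ = X * Yᵀ := by
  have hL : 0 < L := hμ.trans_le hμL
  set S : Matrix (Fin d₁ ⊕ Fin d₂) (Fin d₁ ⊕ Fin d₂) ℝ :=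
    fromBlocks (lam • 1) g gᵀ (lam • 1) with hS
  set T : Matrix (Fin d₁ ⊕ Fin d₂) (Fin d₁ ⊕ Fin d₂) ℝ :=
    fromBlocks (lam • 1) g' g'ᵀ (lam • 1) with hTdef
  set Pt : Matrix (Fin d₁ ⊕ Fin d₂) (Fin d₁ ⊕ Fin d₂) ℝ := fromBlocks P 0 0 Q with hPt
  set W := fromRows X Y with hW
  have hSt : Sᵀ = S := by simp [hS, fromBlocks_transpose]
  have hSU : S * fromRows U V = 0 := by
    rw [hS, fromBlocks_mul_fromRows, smul_mul, smul_mul, Matrix.one_mul, Matrix.one_mul,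
      add_comm (lam • U), hgV, hgU, fromRows_zero]
  have hD' : Pt * (S - T) * Pt = fromBlocks 0 D Dᵀ 0 := by
    have : S - T = fromBlocks 0 (g - g') (g - g')ᵀ 0 := by
      rw [hS, hTdef, fromBlocks_sub_fromBlocks]; simp
    rw [this, hPt, fromBlocks_multiply, fromBlocks_multiply, hD]
    simp [transpose_mul, hP.1, hQ.1, Matrix.mul_assoc]
  have hΔ : fromRows U V * (fromRows U V)ᵀ - W * Wᵀ =
      fromBlocks (U * Uᵀ - X * Xᵀ) (U * Vᵀ - X * Yᵀ) (U * Vᵀ - X * Yᵀ)ᵀ (V * Vᵀ - Y * Yᵀ) := by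
    rw [hW, transpose_fromRows, fromRows_mul_fromCols, transpose_fromRows, fromRows_mul_fromCols,
      fromBlocks_sub_fromBlocks]
    simp
  have hPtP : IsOrthProj Pt := by
    constructor
    · rw [hPt, fromBlocks_transpose, hP.1, hQ.1]; simp
    · rw [hPt, fromBlocks_multiply]; simp [hP.2, hQ.2]
  have : Nonempty (Fin r) := ⟨⟨0, by omega⟩⟩
  obtain ⟨w, hw, hmin⟩ := exists_min_direction (fromRows U V)
  set a := U *ᵥ w with ha
  set b := V *ᵥ w with hb
  have hab : fromRows U V *ᵥ w = Sum.elim a b := fromRows_mulVec U V w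
  have haa : a ⬝ᵥ a = b ⬝ᵥ b := by
    rw [ha, hb, mulVec_dotProduct_mulVec, hbal, ← mulVec_dotProduct_mulVec]
  rw [hab] at hmin
  set s := Sum.elim a b ⬝ᵥ Sum.elim a b with hs
  have hs2 : s = 2 * (b ⬝ᵥ b) := by rw [hs, dotProduct_sum_elim, haa]; ring
  have hs0 : 0 ≤ s := dotProduct_self_nonneg' _
  -- Balance gives |a|² = |b|² = s/2, whence the factor L₂/2. Orthogonality to (a, b) turns the
  -- cross term of ‖ayᵀ + xbᵀ‖² into -2(y·b)², which may be dropped.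
  have hlow : ∀ z, -(L₂ / 2 * s) * (z ⬝ᵥ z) ≤ z ⬝ᵥ (S *ᵥ z) := by
    refine quadratic_lower_bound_of_orthogonal hSt (a := Sum.elim a b) ?_ (by positivity) ?_
    · rw [← hab, Matrix.mulVec_mulVec, hSU, Matrix.zero_mulVec]
    intro z hz
    obtain ⟨x, y, rfl⟩ : ∃ x y, z = Sum.elim x y := ⟨z ∘ Sum.inl, z ∘ Sum.inr, by simp⟩
    rw [dotProduct_sum_elim] at hz
    rw [hS, sum_elim_quadratic, dotProduct_sum_elim]
    have e1 : U * (vecMulVec y w)ᵀ = vecMulVec a y := by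
      rw [transpose_vecMulVec, mul_vecMulVec]
    have e2 : vecMulVec x w * Vᵀ = vecMulVec x b := by
      rw [vecMulVec_mul, vecMul_transpose]
    have e3 : vecMulVec x w * (vecMulVec y w)ᵀ = vecMulVec x y := by
      rw [transpose_vecMulVec, vecMulVec_mul_vecMulVec, hw]
      simp
    have h1 := hsec (vecMulVec x w) (vecMulVec y w)
    have h2 := hH (vecMulVec a y + vecMulVec x b)
      ((matrix_rank_add_le _ _).trans (add_le_add (rank_vecMulVec_le _ _) (rank_vecMulVec_le _ _)))
    rw [trForm_add_left, trForm_add_right, trForm_add_right, trForm_vecMulVec_vecMulVec,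
      trForm_vecMulVec_vecMulVec, trForm_vecMulVec_vecMulVec, trForm_vecMulVec_vecMulVec, haa,
      dotProduct_comm a x, dotProduct_comm b y] at h2
    rw [e1, e2, e3, trForm_vecMulVec, trForm_vecMulVec_vecMulVec, trForm_vecMulVec_vecMulVec,
      hw] at h1
    have h3 : x ⬝ᵥ a = -(y ⬝ᵥ b) := by linarith
    rw [h3] at h2
    have h4 : 0 ≤ L₂ * (y ⬝ᵥ b) ^ 2 := by positivity
    rw [hs2]
    nlinarith
  have hWpsd : (W * Wᵀ).PosSemidef := by
    rw [← conjTranspose_eq_transpose_of_trivial]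
    exact posSemidef_self_mul_conjTranspose W
  have hWr : (W * Wᵀ).rank ≤ rs := by
    have h1 : Wᵀ * W = (2 : ℝ) • Yᵀ * Y := by
      rw [hW, transpose_fromRows, fromCols_mul_fromRows, hXY, Matrix.smul_mul, two_smul]
    calc (W * Wᵀ).rank ≤ W.rank := rank_mul_le_left _ _
      _ = (Wᵀ * W).rank := (rank_transpose_mul_self W).symm
      _ ≤ Y.rank := by rw [h1]; exact rank_mul_le_right _ _
      _ ≤ rs := hYr
  have hPtU : Pt * fromRows U V = fromRows U V := by
    rw [hPt, fromBlocks_mul_fromRows]; simp [hPU, hQV]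
  have hPtW : Pt * (W * Wᵀ) = W * Wᵀ := by
    rw [← Matrix.mul_assoc, hPt, hW, fromBlocks_mul_fromRows]; simp [hPX, hQY]
  have hgap' : L₂ / 2 < μ / 2 * (2 * √((r : ℝ) / rs) + L₂ / 2 / (L / 2)) := by
    have : L₂ / 2 / (L / 2) = L₂ / L := by field_simp
    rw [this]
    linarith
  -- Lifting doubles ⟨D, Δ⟩ and at most quadruples ‖Δ‖², which matches μ/2 and L/2; the gap
  -- condition is homogeneous in the three constants.
  have hmain : fromRows U V * (fromRows U V)ᵀ = W * Wᵀ := by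
    refine eq_of_dual_matrices hrs hr (half_pos hμ) (by linarith : μ / 2 ≤ L / 2)
      (by linarith : 0 ≤ L₂ / 2) hs0 hgap' (fromRows U V) hmin (W * Wᵀ) S T Pt hSt hSU hlow hT
      hWpsd hWr hTM hPtP hPtU hPtW (X := trForm D D) ?_ ?_
    · intro N hN hDN
      rw [hD'] at hDN
      -- Conjugation by J negates the off-diagonal matrix E and keeps N ⪰ 0, so ⟨N, JNJ⟩ ≥ 0 and ‖N
      -- - JNJ‖² ≤ 2‖N‖². Comparing E with N - JNJ instead of N gains the factor 2 needed for ‖N‖² ≤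
      -- ‖D‖² = ‖E‖²/2.
      set J : Matrix (Fin d₁ ⊕ Fin d₂) (Fin d₁ ⊕ Fin d₂) ℝ := fromBlocks 1 0 0 (-1) with hJ
      have hJt : Jᵀ = J := by rw [hJ, fromBlocks_transpose]; simp
      have hJJ : J * J = 1 := by rw [hJ, fromBlocks_multiply]; simp
      set E := fromBlocks 0 D Dᵀ 0 with hE
      have hJE : J * E * J = -E := by
        rw [hJ, hE, fromBlocks_multiply, fromBlocks_multiply, fromBlocks_neg]; simp
      have hEE : trForm E E = 2 * trForm D D := by
        rw [hE, trForm_fromBlocks, trForm_transpose]; simp; ring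
      have hN' : (J * N * J).PosSemidef := by
        have := hN.mul_mul_conjTranspose_same J
        rwa [conjTranspose_eq_transpose_of_trivial, hJt] at this
      have h1 : trForm E (J * N * J) = -trForm E N := by
        rw [trForm_comm, trForm_mul_right, trForm_mul_left, hJt, ← Matrix.mul_assoc, hJE,
          trForm_comm, ← neg_one_smul ℝ E, trForm_smul_left]
        ring
      have h2 : trForm (J * N * J) (J * N * J) = trForm N N := by
        rw [trForm_mul_right, trForm_mul_left, hJt]
        simp only [← Matrix.mul_assoc, hJJ, Matrix.one_mul]
        rw [Matrix.mul_assoc, hJJ, Matrix.mul_one]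
      have h3 := trForm_nonneg_of_psd hN hN'
      have h4 := trForm_self_nonneg (E + (N - J * N * J))
      rw [trForm_add_left, trForm_add_right, trForm_add_right, trForm_comm (N - J * N * J) E,
        trForm_sub_right E, h1, trForm_sub_left, trForm_sub_right, trForm_sub_right, h2,
        trForm_comm (J * N * J) N, hEE] at h4
      linarith
    · rw [hD', hΔ, trForm_fromBlocks, trForm_fromBlocks, trForm_transpose, trForm_transpose]
      have h1 := balanced_diagonal_blocks_le hbal hXY
      have h2 : 0 ≤ μ * L := by positivity
      simp only [trForm_zero_left, zero_add, add_zero]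
      nlinarith
  have := sub_eq_zero.mpr hmain
  rw [hΔ, ← fromBlocks_zero, fromBlocks_inj] at this
  exact sub_eq_zero.mp this.2.1

end AsymmetricLandscape

/-! ### The asymmetric case: reduction to balanced factors. -/

section AsymmetricMain

variable {m n p : Type*} [Fintype m] [Fintype n] [Fintype p]

lemma posDef_gram_of_injective {U : Matrix m p ℝ} (h : ∀ w, U *ᵥ w = 0 → w = 0) :
    (Uᵀ * U).PosDef := by
  refine PosDef.of_dotProduct_mulVec_pos ?_ fun w hw => ?_
  · rw [Matrix.IsHermitian, conjTranspose_eq_transpose_of_trivial]; simp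
  · rw [star_trivial, ← mulVec_dotProduct_mulVec]
    refine lt_of_le_of_ne (dotProduct_self_nonneg' _) fun h0 => hw (h w ?_)
    exact dotProduct_self_eq_zero.mp h0.symm

/-- An affine function bounded below on the whole line is constant. -/
lemma nonpos_of_forall_nonneg_sub {c e : ℝ} (h : ∀ t : ℝ, 0 ≤ c - t * e) : e = 0 := by
  by_contra he
  have := h ((c + 1) / e)
  rw [div_mul_cancel₀ _ he] at this
  linarith

/-- Without regularization, the gradient vanishes at rank-deficient second-order critical points. -/
lemma gradient_eq_zero_of_kernel {U : Matrix m p ℝ} {V : Matrix n p ℝ} {g : Matrix m n ℝ}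
    {H : Matrix m n ℝ → ℝ}
    (hsec : ∀ (X : Matrix m p ℝ) (Y : Matrix n p ℝ),
      0 ≤ H (U * Yᵀ + X * Vᵀ) + 2 * trForm g (X * Yᵀ))
    {w : p → ℝ} (hw : w ≠ 0) (hUw : U *ᵥ w = 0) : g = 0 := by
  have hww : w ⬝ᵥ w ≠ 0 := fun h => hw (dotProduct_self_eq_zero.mp h)
  have key : ∀ x y, x ⬝ᵥ (g *ᵥ y) = 0 := by
    intro x y
    have : 2 * ((w ⬝ᵥ w) * (x ⬝ᵥ (g *ᵥ y))) = 0 := by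
      -- As Uw = 0, the direction (x wᵀ, -t y wᵀ) changes UVᵀ to first order by x(Vw)ᵀ, independent
      -- of t, while the gradient term is linear in t.
      refine nonpos_of_forall_nonneg_sub (c := H (vecMulVec x (V *ᵥ w))) fun t => ?_
      have h1 := hsec (vecMulVec x w) (vecMulVec ((-t) • y) w)
      rw [transpose_vecMulVec, mul_vecMulVec, hUw, zero_vecMulVec, zero_add, vecMulVec_mul,
        vecMul_transpose, vecMulVec_mul_vecMulVec, trForm_vecMulVec, mulVec_smul, mulVec_smul,
        dotProduct_smul, dotProduct_smul] at h1
      simp only [smul_eq_mul] at h1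
      linarith
    simpa [hww] using this
  classical
  ext i j
  have := key (Pi.single i 1) (Pi.single j 1)
  simpa using this

end AsymmetricMain

/-- The asymmetric case: second-order critical points are optimal. -/
theorem asymObjective_landscape {r rs : ℕ} (hrs : 1 ≤ rs) (hr : rs ≤ r) {lam : ℝ} (hlam : 0 ≤ lam)
    {d₁ d₂ : ℕ} {φ : Matrix (Fin d₁) (Fin d₂) ℝ → ℝ}
    (hφ : LandscapeCondition Matrix.rank univ φ r rs) {Mstar : Matrix (Fin d₁) (Fin d₂) ℝ}
    (hMr : Mstar.rank ≤ rs) (hopt : IsAsymOptimum φ lam Mstar) {U : Matrix (Fin d₁) (Fin r) ℝ}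
    {V : Matrix (Fin d₂) (Fin r) ℝ} (hUV : IsSecondOrderCritical (asymObjective r φ lam) (U, V)) :
    U * Vᵀ = Mstar := by
  by_contra hne
  obtain ⟨X, Y, hM, hXY, hnuc, hXr, hYr⟩ := exists_balanced_factorization Mstar
  obtain ⟨P, hP, hPU, hPX, hPr, -⟩ := exists_projection_rank_le U X
  obtain ⟨Q, hQ, hQV, hQY, -, -⟩ := exists_projection_rank_le V Y
  have hPk : P.rank ≤ r + rs := hPr.trans (add_le_add (rank_le_width U) (hXr.trans hMr))
  have hUVT := mul_transpose_mem_asymSupported hQ hPU hQV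
  have hMT := mul_transpose_mem_asymSupported hQ hPX hQY
  have hrk : ∀ Z ∈ asymSupported P Q, Z.rank ≤ r + rs := by
    intro Z hZ
    have hZ' : P * Z * Q = Z := hZ
    rw [← hZ', Matrix.mul_assoc]
    exact (rank_mul_le_left _ _).trans hPk
  rw [hM] at hne
  obtain ⟨μ, L, L₂, hμ, hμL, hL₂, hgap, hφ2, hbd, hbd2⟩ :=
    hφ.exists_constants hrs hr (mem_univ (U * Vᵀ)) (hrk _ hUVT) (sub_ne_zero.mpr hne)
      (hrk _ (Submodule.sub_mem _ hUVT hMT))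
  obtain ⟨hT, hTM⟩ := hopt.dual_certificate hlam hM hnuc
  obtain ⟨hgV, hgU, hsec⟩ := asymObjective_critical hφ2 hUV
  have hcoc := asym_cocoercivity hφ2 hμL hbd hP hQ hPk hUVT hMT rfl
  rw [← hM] at hcoc
  set g := gradient φ (U * Vᵀ) with hg
  set g' := gradient φ Mstar with hg'
  set H := hessForm φ univ (U * Vᵀ) with hHdef
  have hH : ∀ Z : Matrix (Fin d₁) (Fin d₂) ℝ, Z.rank ≤ 2 → H Z ≤ L₂ * trForm Z Z := by
    intro Z hZ
    rw [← norm_sq_eq_trForm]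
    exact hbd2 _ (mem_univ _) (hrk _ hUVT) Z hZ
  have hYr' := hYr.trans hMr
  -- Without regularization balance is not automatic, but the objective then depends on UVᵀ alone
  -- and is invariant under (U, V) ↦ (UB, VB⁻ᵀ) for invertible B.
  rcases hlam.eq_or_lt with h0 | hpos
  · subst h0
    simp only [zero_smul, add_zero, zero_mul] at hgV hgU hsec
    have hg'0 : g' = 0 := by
      obtain ⟨G, -, hG⟩ := hopt
      rw [hg', hG]; simp
    have hgne : g ≠ 0 := by
      intro hg0
      rw [hg0, hg'0] at hcoc
      simp only [sub_self, Matrix.mul_zero, Matrix.zero_mul, trForm_zero_left, zero_add,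
        mul_zero] at hcoc
      have h1 : trForm (U * Vᵀ - Mstar) (U * Vᵀ - Mstar) ≤ 0 :=
        nonpos_of_mul_nonpos_right hcoc (mul_pos hμ (hμ.trans_le hμL))
      rw [← hM, ← sub_eq_zero] at hne
      exact hne (trForm_self_eq_zero.mp (le_antisymm h1 (trForm_self_nonneg _)))
    have hUinj : ∀ w, U *ᵥ w = 0 → w = 0 := fun w hUw => by
      by_contra hw
      exact hgne (gradient_eq_zero_of_kernel hsec hw hUw)
    have hVinj : ∀ w, V *ᵥ w = 0 → w = 0 := fun w hVw => by
      by_contra hw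
      have hgt : gᵀ = 0 := by
        refine gradient_eq_zero_of_kernel (H := fun Z => H Zᵀ) (U := V) (V := U)
          (fun X Y => ?_) hw hVw
        have := hsec Y X
        rw [← trForm_transpose] at this
        simpa [add_comm] using this
      exact hgne (by rw [← transpose_transpose g, hgt, transpose_zero])
    obtain ⟨B, B', hBt, hBt', hBB', hB'B, hbal⟩ :=
      exists_balancing (posDef_gram_of_injective hUinj) (posDef_gram_of_injective hVinj)
    have hprod : U * B * (V * B')ᵀ = U * Vᵀ := by
      rw [transpose_mul, hBt', Matrix.mul_assoc, ← Matrix.mul_assoc B, hBB', Matrix.one_mul]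
    rw [hM, ← hprod] at hcoc
    refine hne ?_
    rw [← hprod]
    refine asym_landscape_of_balanced hrs hr hμ hμL hL₂ hgap (lam := 0) (g := g) ?_ ?_ ?_ hH ?_ hXY
      hYr' hT hTM hP hQ ?_ hPX ?_ hQY rfl hcoc
    · rw [transpose_mul, transpose_mul, hBt, hBt']
      simpa only [Matrix.mul_assoc] using hbal
    · rw [← Matrix.mul_assoc, hgV]; simp
    · rw [← Matrix.mul_assoc, hgU]; simp
    · intro X Y
      -- The direction (X, Y) at the balanced pair corresponds to (XB', YB) at the original one.
      have h1 := hsec (X * B') (Y * B)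
      have h2 : X * B' * (Y * B)ᵀ = X * Yᵀ := by
        rw [transpose_mul, hBt, Matrix.mul_assoc, ← Matrix.mul_assoc B', hB'B, Matrix.one_mul]
      rw [h2] at h1
      rw [zero_mul, add_zero]
      simpa only [transpose_mul, hBt, hBt', Matrix.mul_assoc] using h1
    · rw [← Matrix.mul_assoc, hPU]
    · rw [← Matrix.mul_assoc, hQV]
  · refine hne (asym_landscape_of_balanced hrs hr hμ hμL hL₂ hgap ?_ hgV hgU hH hsec hXY
      hYr' hT hTM hP hQ hPU hPX hQV hQY rfl (by rw [← hM]; exact hcoc))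
    -- The two first-order equations express λUᵀU and λVᵀV as transposes of each other; both are
    -- symmetric and λ > 0.
    have h1 : lam • (Uᵀ * U) = -(Uᵀ * g * V) := by
      rw [Matrix.mul_assoc, ← Matrix.mul_smul, eq_neg_iff_add_eq_zero, ← Matrix.mul_add, add_comm,
        hgV, Matrix.mul_zero]
    have h2 : lam • (Vᵀ * V) = -(Vᵀ * gᵀ * U) := by
      rw [Matrix.mul_assoc, ← Matrix.mul_smul, eq_neg_iff_add_eq_zero, ← Matrix.mul_add, add_comm,
        hgU, Matrix.mul_zero]
    have h3 := congrArg transpose h2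
    simp only [transpose_smul, transpose_neg, transpose_mul, transpose_transpose] at h3
    rw [← Matrix.mul_assoc, ← h1] at h3
    exact smul_right_injective _ hpos.ne' h3.symm

theorem theorem3p5 (r rs : ℕ) (hrs : 1 ≤ rs) (hr : rs ≤ r) (lam : ℝ) (hlam : 0 ≤ lam) :
    -- asymmetric case
    (∀ (d₁ d₂ : ℕ) (φ : Matrix (Fin d₁) (Fin d₂) ℝ → ℝ),
      LandscapeCondition Matrix.rank Set.univ φ r rs →
      ∀ Mstar : Matrix (Fin d₁) (Fin d₂) ℝ, Mstar.rank ≤ rs → IsAsymOptimum φ lam Mstar →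
      ∀ (U : Matrix (Fin d₁) (Fin r) ℝ) (V : Matrix (Fin d₂) (Fin r) ℝ),
        IsSecondOrderCritical (asymObjective r φ lam) (U, V) → U * Vᵀ = Mstar) ∧
    -- symmetric positive semidefinite case
    (∀ (d : ℕ) (φ : SymMat d → ℝ),
      LandscapeCondition (fun M : SymMat d => (M : Matrix (Fin d) (Fin d) ℝ).rank)
        (psdCone d) φ r rs →
      ∀ Mstar : SymMat d, (Mstar : Matrix (Fin d) (Fin d) ℝ).rank ≤ rs →
        IsSymOptimum φ lam Mstar →
      ∀ U : Matrix (Fin d) (Fin r) ℝ,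
        IsSecondOrderCritical (symObjective r φ lam) U →
          U * Uᵀ = (Mstar : Matrix (Fin d) (Fin d) ℝ)) := by
  exact ⟨fun _ _ _ hφ _ hMr hopt _ _ hUV => asymObjective_landscape hrs hr hlam hφ hMr hopt hUV,
    fun _ _ hφ _ hMr hopt _ hU => symObjective_landscape hrs hr hφ hMr hopt hU⟩
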